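/- **Theorem.** There exist universal constants $c, p > 0$ such that the following holds for all dimensions $d_x, d_u$. Let $R_x \in \mathbb{R}^{d_x\times d_x}$ be symmetric with $R_x \succeq I$ and let $R_u = I \in \mathbb{R}^{d_u \times d_u}$. Call $(A,B) \in \mathbb{R}^{d_x\times d_x}\times\mathbb{R}^{d_x\times d_u}$ *stabilizable* if there is a $K \in \mathbb{R}^{d_u\times d_x}$ such that $A+BK$ has spectral radius $\rho(A+BK)<1$. For stabilizable $(A,B)$ let $P_\infty(A,B)$ be the (unique) positive semidefinite solution of the discrete algebraic Riccati equation $$P = A^\top P A - A^\top P B (R_u + B^\top P B)^{-1} B^\top P A + R_x,$$ and let $$K_\infty(A,B) = -(R_u + B^\top P_\infty(A,B) B)^{-1} B^\top P_\infty(A,B) A ,\qquad C_{\mathrm{safe}}(A,B) = 54\,\|P_\infty(A,B)\|_{\mathrm{op}}^5 .$$ Let $(A_\star,B_\star)$ be stabilizable, write $P_\star = P_\infty(A_\star,B_\star)$ and $K_\star = K_\infty(A_\star,B_\star)$, let $(\widehat A,\widehat B)$ be another pair of matrices of the same sizes, and for $\circ \in \{\mathrm{op}, F\}$ (spectral norm,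 Frobenius norm) put $\epsilon_\circ = \max\{\|\widehat A - A_\star\|_\circ, \|\widehat B - B_\star\|_\circ\}$. Suppose that $\epsilon_{\mathrm{op}} \le 1/C_{\mathrm{safe}}(A_\star,B_\star)$. Then $(A_\star + t(\widehat A - A_\star),\, B_\star + t(\widehat B - B_\star))$ is stabilizable for every $t\in[0,1]$, the derivative $$K' = \frac{d}{dt} K_\infty\bigl(A_\star + t(\widehat A - A_\star),\, B_\star + t(\widehat B - B_\star)\bigr)\Big|_{t=0}$$ exists, and for both $\circ = \mathrm{op}$ and $\circ = F$ $$\bigl\|K_\infty(\widehat A,\widehat B) - (K_\star + K')\bigr\|_\circ^2 \le c\, \|P_\star\|_{\mathrm{op}}^p\, \epsilon_{\mathrm{op}}^2\, \epsilon_\circ^2 .$$ -/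

import Mathlib

/-- The two matrix norms: the spectral (operator) norm and the Frobenius norm. -/
inductive MatNorm
  | op
  | fro

section OperatorNorm

open scoped Matrix.Norms.L2Operator

/-- The spectral norm of a rectangular real matrix (operator norm for the Euclidean norms). -/
noncomputable def opNorm {n m : ℕ} (M : Matrix (Fin n) (Fin m) ℝ) : ℝ := ‖M‖

end OperatorNorm

section FrobeniusNorm

open scoped Matrix.Norms.Frobenius

/-- The Frobenius norm of a rectangular real matrix. -/
noncomputable def froNorm {n m : ℕ} (M : Matrix (Fin n) (Fin m) ℝ) : ℝ := ‖M‖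

end FrobeniusNorm

namespace LQR

open scoped Matrix

/-- The norm of a matrix of the given kind. -/
noncomputable def circNorm (ν : MatNorm) {n m : ℕ} (M : Matrix (Fin n) (Fin m) ℝ) : ℝ :=
  match ν with
  | MatNorm.op => opNorm M
  | MatNorm.fro => froNorm M

variable {n m : ℕ}

/-- A real square matrix is stable if its (complex) spectral radius is less than one. -/
def Stable (X : Matrix (Fin n) (Fin n) ℝ) : Prop :=
  spectralRadius ℂ (X.map (algebraMap ℝ ℂ)) < 1

/-- `(A, B)` is stabilizable if `A + B K` is stable for some controller `K`. -/
def Stabilizable (A : Matrix (Fin n) (Fin n) ℝ) (B : Matrix (Fin n) (Fin m) ℝ) : Prop :=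
  ∃ K : Matrix (Fin m) (Fin n) ℝ, Stable (A + B * K)

/-- `P` is a positive semidefinite solution of the discrete algebraic Riccati equation. -/
def IsDARESolution (Rx : Matrix (Fin n) (Fin n) ℝ) (Ru : Matrix (Fin m) (Fin m) ℝ)
    (A : Matrix (Fin n) (Fin n) ℝ) (B : Matrix (Fin n) (Fin m) ℝ)
    (P : Matrix (Fin n) (Fin n) ℝ) : Prop :=
  P.PosSemidef ∧ P = Aᵀ * P * A - Aᵀ * P * B * (Ru + Bᵀ * P * B)⁻¹ * Bᵀ * P * A + Rx

open Classical in
/-- `P_∞(A, B)`: the positive semidefinite solution of the Riccati equation. It exists and is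
unique when `(A, B)` is stabilizable and `Rx`, `Ru` are positive definite; the value is `0` when
there is no such solution. -/
noncomputable def Pinf (Rx : Matrix (Fin n) (Fin n) ℝ) (Ru : Matrix (Fin m) (Fin m) ℝ)
    (A : Matrix (Fin n) (Fin n) ℝ) (B : Matrix (Fin n) (Fin m) ℝ) :
    Matrix (Fin n) (Fin n) ℝ :=
  if h : ∃ P, IsDARESolution Rx Ru A B P then h.choose else 0

/-- `K_∞(A, B) = -(Ru + Bᵀ P B)⁻¹ Bᵀ P A` with `P = P_∞(A, B)`: the optimal infinite-horizon
controller. -/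
noncomputable def Kinf (Rx : Matrix (Fin n) (Fin n) ℝ) (Ru : Matrix (Fin m) (Fin m) ℝ)
    (A : Matrix (Fin n) (Fin n) ℝ) (B : Matrix (Fin n) (Fin m) ℝ) :
    Matrix (Fin m) (Fin n) ℝ :=
  -((Ru + Bᵀ * Pinf Rx Ru A B * B)⁻¹ * Bᵀ * Pinf Rx Ru A B * A)

/-- `C_safe(A, B) = 54 ‖P_∞(A, B)‖_op ^ 5`. -/
noncomputable def Csafe (Rx : Matrix (Fin n) (Fin n) ℝ) (Ru : Matrix (Fin m) (Fin m) ℝ)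
    (A : Matrix (Fin n) (Fin n) ℝ) (B : Matrix (Fin n) (Fin m) ℝ) : ℝ :=
  54 * opNorm (Pinf Rx Ru A B) ^ 5

/-- `ε_∘ = max {‖Â - A‖_∘, ‖B̂ - B‖_∘}`. -/
noncomputable def modelErr (ν : MatNorm) (A A' : Matrix (Fin n) (Fin n) ℝ)
    (B B' : Matrix (Fin n) (Fin m) ℝ) : ℝ :=
  max (circNorm ν (A' - A)) (circNorm ν (B' - B))

end LQR

/-! A solution `P` of the Riccati equation is a Lyapunov function for its own closed loop `L`: since
`Rx ≥ 1`, the form `P` drops by at least `|x|²` along `L`. With `1 ≤ P ≤ p` this gives geometric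
decay of `L ^ k`, so any solution of `X = L₁ᵀ X L₂ + S` satisfies `‖X‖ ≤ p² ‖S‖`
(`circNorm_le_of_sylvester`).

Under the smallness hypothesis, `2P` is a supersolution for the perturbed system driven by the old
gain (`perturbed_decrease`). The perturbed system is therefore stabilizable and its Riccati solution
has norm at most `2‖P‖` (`opNorm_perturbed_le`), so one constant `p = 2‖P‖` serves the whole
segment.

Exact identities then replace differentiation of the Riccati map. `sub_eq_sylvester` makes `P₁ - P`
first order; `sub_eq_lyapunov` isolates its linear part `Pd`, the solution of a Lyapunov equation,
and leaves a quadratic remainder; `sub_gain` transfers this to the gains. A remainder uniform in the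
system gives both the derivative (remainder `O(t²)` along the segment) and the estimate (`t = 1`).

Two devices give the form of the bound. In each product only one factor is measured in the norm `ν`
and all others in operator norm, whence `ε_op ε_∘`. No bound on `B` is needed, because `B` occurs
only next to `N = (1 + Bᵀ P B)⁻¹`, and `P ≥ 1` bounds `N`, `N Bᵀ` and `B N Bᵀ` by 1. -/

namespace LQR

open scoped Matrix
open Matrix Filter

/-! ### Quadratic forms, operator and Frobenius norms. -/

section Norms

variable {n m l : ℕ}

/-- The quadratic form `x ↦ xᵀ P x`. -/
def qf (P : Matrix (Fin n) (Fin n) ℝ) (x : Fin n → ℝ) : ℝ := x ⬝ᵥ (P *ᵥ x)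

lemma qf_add (P Q : Matrix (Fin n) (Fin n) ℝ) (x : Fin n → ℝ) :
    qf (P + Q) x = qf P x + qf Q x := by
  simp [qf, add_mulVec]

lemma qf_sub (P Q : Matrix (Fin n) (Fin n) ℝ) (x : Fin n → ℝ) :
    qf (P - Q) x = qf P x - qf Q x := by
  simp [qf, sub_mulVec]

lemma qf_smul (a : ℝ) (P : Matrix (Fin n) (Fin n) ℝ) (x : Fin n → ℝ) :
    qf (a • P) x = a * qf P x := by
  simp [qf, smul_mulVec]

lemma qf_zero (x : Fin n → ℝ) : qf 0 x = 0 := by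
  simp [qf]

lemma qf_one (x : Fin n → ℝ) : qf 1 x = x ⬝ᵥ x := by
  simp [qf]

lemma qf_conj (P : Matrix (Fin n) (Fin n) ℝ) (C : Matrix (Fin n) (Fin m) ℝ) (x : Fin m → ℝ) :
    qf (Cᵀ * P * C) x = qf P (C *ᵥ x) := by
  simp only [qf, ← mulVec_mulVec, dotProduct_mulVec, vecMul_transpose]

lemma qf_transpose_mul_self (C : Matrix (Fin n) (Fin m) ℝ) (x : Fin m → ℝ) :
    qf (Cᵀ * C) x = (C *ᵥ x) ⬝ᵥ (C *ᵥ x) := by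
  simp only [qf, ← mulVec_mulVec, dotProduct_mulVec, vecMul_transpose]

lemma dot_self_nonneg (x : Fin n → ℝ) : 0 ≤ x ⬝ᵥ x := by
  simpa using dotProduct_star_self_nonneg x

lemma norm_toLp_sq (x : Fin n → ℝ) : ‖WithLp.toLp 2 x‖ ^ 2 = x ⬝ᵥ x := by
  rw [EuclideanSpace.norm_sq_eq]
  simp [dotProduct, sq]

section Op

open scoped Matrix.Norms.L2Operator

lemma opNorm_nonneg (X : Matrix (Fin n) (Fin m) ℝ) : 0 ≤ opNorm X := norm_nonneg X

lemma dot_mulVec_le (X : Matrix (Fin n) (Fin m) ℝ) (x : Fin m → ℝ) :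
    (X *ᵥ x) ⬝ᵥ (X *ᵥ x) ≤ opNorm X ^ 2 * (x ⬝ᵥ x) := by
  have h := l2_opNorm_mulVec X (WithLp.toLp 2 x)
  rw [← norm_toLp_sq, ← norm_toLp_sq, ← mul_pow]
  exact pow_le_pow_left₀ (norm_nonneg _) h 2

lemma opNorm_le_of_dot_le (X : Matrix (Fin n) (Fin m) ℝ) {c : ℝ} (hc : 0 ≤ c)
    (h : ∀ x, (X *ᵥ x) ⬝ᵥ (X *ᵥ x) ≤ c ^ 2 * (x ⬝ᵥ x)) : opNorm X ≤ c := by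
  unfold opNorm
  rw [l2_opNorm_def]
  refine ContinuousLinearMap.opNorm_le_bound _ hc fun x => ?_
  have h1 := h x.ofLp
  rw [← norm_toLp_sq, ← norm_toLp_sq, ← mul_pow] at h1
  exact (pow_le_pow_iff_left₀ (norm_nonneg _) (by positivity) two_ne_zero).1 h1

lemma opNorm_mul_le (A : Matrix (Fin n) (Fin m) ℝ) (X : Matrix (Fin m) (Fin l) ℝ) :
    opNorm (A * X) ≤ opNorm A * opNorm X := l2_opNorm_mul A X

lemma opNorm_transpose (X : Matrix (Fin n) (Fin m) ℝ) : opNorm Xᵀ = opNorm X := by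
  rw [← conjTranspose_eq_transpose_of_trivial]
  exact l2_opNorm_conjTranspose X

lemma opNorm_add_le (X Y : Matrix (Fin n) (Fin m) ℝ) :
    opNorm (X + Y) ≤ opNorm X + opNorm Y := norm_add_le X Y

lemma opNorm_neg (X : Matrix (Fin n) (Fin m) ℝ) : opNorm (-X) = opNorm X := norm_neg X

lemma opNorm_smul (a : ℝ) (X : Matrix (Fin n) (Fin m) ℝ) : opNorm (a • X) = |a| * opNorm X :=
  norm_smul a X

lemma opNorm_eq_zero {X : Matrix (Fin n) (Fin m) ℝ} : opNorm X = 0 ↔ X = 0 := norm_eq_zero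

lemma tendsto_zero_of_opNorm {u : ℕ → Matrix (Fin n) (Fin m) ℝ}
    (h : Filter.Tendsto (fun k => opNorm (u k)) Filter.atTop (nhds 0)) :
    Filter.Tendsto u Filter.atTop (nhds 0) := tendsto_zero_iff_norm_tendsto_zero.2 h

lemma tendsto_opNorm_zero {u : ℕ → Matrix (Fin n) (Fin m) ℝ}
    (h : Filter.Tendsto u Filter.atTop (nhds 0)) :
    Filter.Tendsto (fun k => opNorm (u k)) Filter.atTop (nhds 0) :=
  tendsto_zero_iff_norm_tendsto_zero.1 h

/-- A remainder of order `t²` is `o(t)`; the existence of the derivative of the gain rests on this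
alone. -/
lemma hasDerivAt_of_opNorm_sub_le {f : ℝ → Matrix (Fin n) (Fin m) ℝ}
    {K' : Matrix (Fin n) (Fin m) ℝ} {C : ℝ}
    (h : ∀ t : ℝ, |t| ≤ 1 → opNorm (f t - (f 0 + t • K')) ≤ C * t ^ 2) :
    HasDerivAt f K' 0 := by
  rw [hasDerivAt_iff_isLittleO_nhds_zero]
  have hO : (fun t : ℝ => f (0 + t) - f 0 - t • K') =O[nhds 0] fun t : ℝ => t ^ 2 := by
    refine Asymptotics.IsBigO.of_bound C ?_
    filter_upwards [Metric.closedBall_mem_nhds (0 : ℝ) one_pos] with t ht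
    have := h t (by simpa using ht)
    rw [zero_add, sub_sub, Real.norm_of_nonneg (sq_nonneg t)]
    exact this
  refine hO.trans_isLittleO ?_
  simpa using Asymptotics.isLittleO_pow_pow (𝕜 := ℝ) (m := 1) (n := 2) (by norm_num)

end Op

section Fro

open scoped Matrix.Norms.Frobenius

lemma froNorm_nonneg (X : Matrix (Fin n) (Fin m) ℝ) : 0 ≤ froNorm X := norm_nonneg X

lemma froNorm_add_le (X Y : Matrix (Fin n) (Fin m) ℝ) :
    froNorm (X + Y) ≤ froNorm X + froNorm Y := norm_add_le X Y

lemma froNorm_neg (X : Matrix (Fin n) (Fin m) ℝ) : froNorm (-X) = froNorm X := norm_neg X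

lemma froNorm_transpose (X : Matrix (Fin n) (Fin m) ℝ) : froNorm Xᵀ = froNorm X :=
  frobenius_norm_transpose X

lemma froNorm_eq_zero {X : Matrix (Fin n) (Fin m) ℝ} : froNorm X = 0 ↔ X = 0 := norm_eq_zero

lemma froNorm_sq (X : Matrix (Fin n) (Fin m) ℝ) :
    froNorm X ^ 2 = ∑ j, X.col j ⬝ᵥ X.col j := by
  unfold froNorm
  rw [frobenius_norm_def, ← Real.sqrt_eq_rpow, Real.sq_sqrt (by positivity), Finset.sum_comm]
  simp [dotProduct, sq, Matrix.col]

end Fro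

/-- The squared Frobenius norm sums the squared lengths of the columns, and each column of `A * X`
is `A` applied to a column of `X`. -/
lemma froNorm_mul_le_left (A : Matrix (Fin n) (Fin m) ℝ) (X : Matrix (Fin m) (Fin l) ℝ) :
    froNorm (A * X) ≤ opNorm A * froNorm X := by
  refine (pow_le_pow_iff_left₀ (froNorm_nonneg _)
    (mul_nonneg (opNorm_nonneg _) (froNorm_nonneg _)) two_ne_zero).1 ?_
  rw [mul_pow, froNorm_sq, froNorm_sq, Finset.mul_sum]
  refine Finset.sum_le_sum fun j _ => ?_
  exact dot_mulVec_le A (X.col j)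

variable (ν : MatNorm)

lemma circNorm_nonneg (X : Matrix (Fin n) (Fin m) ℝ) : 0 ≤ circNorm ν X := by
  cases ν
  exacts [opNorm_nonneg X, froNorm_nonneg X]

lemma circNorm_transpose (X : Matrix (Fin n) (Fin m) ℝ) : circNorm ν Xᵀ = circNorm ν X := by
  cases ν
  exacts [opNorm_transpose X, froNorm_transpose X]

lemma circNorm_eq_zero {X : Matrix (Fin n) (Fin m) ℝ} : circNorm ν X = 0 ↔ X = 0 := by
  cases ν
  exacts [opNorm_eq_zero, froNorm_eq_zero]

lemma circNorm_mul_le_left (A : Matrix (Fin n) (Fin m) ℝ) (X : Matrix (Fin m) (Fin l) ℝ) :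
    circNorm ν (A * X) ≤ opNorm A * circNorm ν X := by
  cases ν
  exacts [opNorm_mul_le A X, froNorm_mul_le_left A X]

lemma circNorm_mul_le_right (X : Matrix (Fin n) (Fin m) ℝ) (A : Matrix (Fin m) (Fin l) ℝ) :
    circNorm ν (X * A) ≤ circNorm ν X * opNorm A := by
  rw [← circNorm_transpose, transpose_mul, mul_comm, ← circNorm_transpose ν X, ← opNorm_transpose A]
  exact circNorm_mul_le_left ν _ _

variable {ν} {X Y : Matrix (Fin n) (Fin m) ℝ} {a b : ℝ}

lemma circNorm_add_le (hX : circNorm ν X ≤ a) (hY : circNorm ν Y ≤ b) :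
    circNorm ν (X + Y) ≤ a + b := by
  refine le_trans ?_ (add_le_add hX hY)
  cases ν
  exacts [opNorm_add_le X Y, froNorm_add_le X Y]

lemma circNorm_neg_le (hX : circNorm ν X ≤ a) : circNorm ν (-X) ≤ a := by
  refine le_trans (le_of_eq ?_) hX
  cases ν
  exacts [opNorm_neg X, froNorm_neg X]

lemma circNorm_sub_le (hX : circNorm ν X ≤ a) (hY : circNorm ν Y ≤ b) :
    circNorm ν (X - Y) ≤ a + b := by
  rw [sub_eq_add_neg]
  exact circNorm_add_le hX (circNorm_neg_le hY)

lemma circNorm_transpose_le (hX : circNorm ν X ≤ a) : circNorm ν Xᵀ ≤ a :=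
  (circNorm_transpose ν X).trans_le hX

/-- Together with the right-hand version, this bounds a product with a single factor in the norm `ν`
and the others in operator norm. -/
lemma circNorm_mul_le_of_left {A : Matrix (Fin l) (Fin n) ℝ} (hA : circNorm MatNorm.op A ≤ a)
    (hX : circNorm ν X ≤ b) : circNorm ν (A * X) ≤ a * b :=
  (circNorm_mul_le_left ν A X).trans
    (mul_le_mul hA hX (circNorm_nonneg ν X) ((opNorm_nonneg A).trans hA))

lemma circNorm_mul_le_of_right {A : Matrix (Fin m) (Fin l) ℝ} (hX : circNorm ν X ≤ a)
    (hA : circNorm MatNorm.op A ≤ b) : circNorm ν (X * A) ≤ a * b :=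
  (circNorm_mul_le_right ν X A).trans
    (mul_le_mul hX hA (opNorm_nonneg A) ((circNorm_nonneg ν X).trans hX))

end Norms

/-! ### Positive semidefinite forms and norm bounds. -/

section Forms

variable {n m : ℕ}

lemma qf_nonneg {P : Matrix (Fin n) (Fin n) ℝ} (hP : P.PosSemidef) (x : Fin n → ℝ) :
    0 ≤ qf P x := by
  simpa [qf] using hP.dotProduct_mulVec_nonneg x

lemma posSemidef_of_qf {P : Matrix (Fin n) (Fin n) ℝ} (hs : Pᵀ = P) (h : ∀ x, 0 ≤ qf P x) :
    P.PosSemidef := by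
  refine .of_dotProduct_mulVec_nonneg ?_ fun x => ?_
  · rw [IsHermitian, conjTranspose_eq_transpose_of_trivial, hs]
  · simpa [qf] using h x

lemma transpose_eq_of_posSemidef {P : Matrix (Fin n) (Fin n) ℝ} (hP : P.PosSemidef) : Pᵀ = P := by
  rw [← conjTranspose_eq_transpose_of_trivial]
  exact hP.isHermitian

lemma dot_sq_le (x y : Fin n → ℝ) : (x ⬝ᵥ y) ^ 2 ≤ (x ⬝ᵥ x) * (y ⬝ᵥ y) := by
  simpa [dotProduct, sq] using Finset.sum_mul_sq_le_sq_mul_sq Finset.univ x y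

lemma abs_qf_le (P : Matrix (Fin n) (Fin n) ℝ) (x : Fin n → ℝ) :
    |qf P x| ≤ opNorm P * (x ⬝ᵥ x) := by
  have h0 := dot_self_nonneg x
  refine abs_le_of_sq_le_sq ?_ (mul_nonneg (opNorm_nonneg P) h0)
  have h1 := dot_sq_le x (P *ᵥ x)
  have h2 := mul_le_mul_of_nonneg_left (dot_mulVec_le P x) h0
  unfold qf
  nlinarith

lemma qf_le (P : Matrix (Fin n) (Fin n) ℝ) (x : Fin n → ℝ) :
    qf P x ≤ opNorm P * (x ⬝ᵥ x) := (le_abs_self _).trans (abs_qf_le P x)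

lemma opNorm_le_of_transpose_mul_le {C : Matrix (Fin n) (Fin m) ℝ} {c : ℝ} (hc : 0 ≤ c)
    (h : ∀ x, qf (Cᵀ * C) x ≤ c ^ 2 * (x ⬝ᵥ x)) : opNorm C ≤ c :=
  opNorm_le_of_dot_le C hc fun x => by rw [← qf_transpose_mul_self]; exact h x

open scoped MatrixOrder in
lemma exists_transpose_mul_self {P : Matrix (Fin n) (Fin n) ℝ} (hP : P.PosSemidef) :
    ∃ C : Matrix (Fin n) (Fin n) ℝ, P = Cᵀ * C := by
  obtain ⟨C, hC⟩ := CStarAlgebra.nonneg_iff_eq_star_mul_self.1 hP.nonneg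
  exact ⟨C, by rw [hC, star_eq_conjTranspose, conjTranspose_eq_transpose_of_trivial]⟩

lemma opNorm_le_of_qf_le {P : Matrix (Fin n) (Fin n) ℝ} (hP : P.PosSemidef) {c : ℝ} (hc : 0 ≤ c)
    (h : ∀ x, qf P x ≤ c * (x ⬝ᵥ x)) : opNorm P ≤ c := by
  obtain ⟨C, hC⟩ := exists_transpose_mul_self hP
  have h1 : opNorm C ≤ √c := opNorm_le_of_transpose_mul_le (Real.sqrt_nonneg c) fun x => by
    rw [Real.sq_sqrt hc, ← hC]
    exact h x
  rw [hC, ← Real.mul_self_sqrt hc]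
  refine (opNorm_mul_le _ _).trans ?_
  rw [opNorm_transpose]
  exact mul_le_mul h1 h1 (opNorm_nonneg C) (Real.sqrt_nonneg c)

end Forms

/-! ### Lyapunov certificates and Sylvester equations. -/

section Lyapunov

variable {n m : ℕ}

/-- `P` certifies that `L` is stable: `1 ≤ P ≤ p` and `Lᵀ P L ≤ P - 1` as quadratic forms. -/
structure IsLyapunov (P L : Matrix (Fin n) (Fin n) ℝ) (p : ℝ) : Prop where
  one_le : 1 ≤ p
  lower : ∀ x, x ⬝ᵥ x ≤ qf P x
  upper : ∀ x, qf P x ≤ p * (x ⬝ᵥ x)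
  decrease : ∀ x, qf P (L *ᵥ x) + x ⬝ᵥ x ≤ qf P x

/-- The geometric rate attached to a Lyapunov certificate. -/
noncomputable def rate (p : ℝ) : ℝ := 1 - 1 / p

lemma rate_nonneg {p : ℝ} (hp : 1 ≤ p) : 0 ≤ rate p := by
  have : 1 / p ≤ 1 := (div_le_one (by linarith)).2 hp
  unfold rate
  linarith

lemma rate_lt_one {p : ℝ} (hp : 1 ≤ p) : rate p < 1 := by
  have : 0 < 1 / p := by positivity
  unfold rate
  linarith

lemma mul_sum_rate_le {p : ℝ} (hp : 1 ≤ p) (N : ℕ) : ∑ k ∈ Finset.range N, rate p ^ k ≤ p := by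
  have h1 := mul_neg_geom_sum (rate p) N
  have h2 : 1 - rate p = 1 / p := by unfold rate; ring
  have h3 : 0 ≤ rate p ^ N := pow_nonneg (rate_nonneg hp) N
  rw [h2, one_div, inv_mul_eq_iff_eq_mul₀ (by linarith)] at h1
  rw [h1]
  nlinarith

lemma IsLyapunov.qf_pow_le {P L : Matrix (Fin n) (Fin n) ℝ} {p : ℝ} (h : IsLyapunov P L p)
    (k : ℕ) (x : Fin n → ℝ) : qf P ((L ^ k) *ᵥ x) ≤ rate p ^ k * qf P x := by
  have hp : 0 < p := by linarith [h.one_le]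
  induction k with
  | zero => simp
  | succ k ih =>
    rw [pow_succ', ← mulVec_mulVec]
    set y := (L ^ k) *ᵥ x
    have h1 := h.decrease y
    -- The upper bound on `P` turns the additive decrease `|y|²` into the factor `1 - 1/p`.
    have h2 : qf P y / p ≤ y ⬝ᵥ y := (div_le_iff₀' hp).2 (h.upper y)
    calc qf P (L *ᵥ y) ≤ rate p * qf P y := by
          have : rate p * qf P y = qf P y - qf P y / p := by unfold rate; ring
          linarith
      _ ≤ rate p * (rate p ^ k * qf P x) :=
          mul_le_mul_of_nonneg_left ih (rate_nonneg h.one_le)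
      _ = _ := by ring

lemma IsLyapunov.opNorm_pow_le {P L : Matrix (Fin n) (Fin n) ℝ} {p : ℝ} (h : IsLyapunov P L p)
    (k : ℕ) : opNorm (L ^ k) ≤ √(p * rate p ^ k) := by
  have hp := h.one_le
  have hr := pow_nonneg (rate_nonneg hp) k
  refine opNorm_le_of_dot_le _ (Real.sqrt_nonneg _) fun x => ?_
  rw [Real.sq_sqrt (by positivity)]
  calc _ ≤ qf P ((L ^ k) *ᵥ x) := h.lower _
    _ ≤ rate p ^ k * qf P x := h.qf_pow_le k x
    _ ≤ rate p ^ k * (p * (x ⬝ᵥ x)) := mul_le_mul_of_nonneg_left (h.upper x) hr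
    _ = _ := by ring

lemma tendsto_mul_rate_pow {p : ℝ} (hp : 1 ≤ p) (a : ℝ) :
    Tendsto (fun k => a * rate p ^ k) atTop (nhds 0) := by
  simpa using (tendsto_pow_atTop_nhds_zero_of_lt_one (rate_nonneg hp) (rate_lt_one hp)).const_mul a

lemma IsLyapunov.tendsto_pow {P L : Matrix (Fin n) (Fin n) ℝ} {p : ℝ} (h : IsLyapunov P L p) :
    Tendsto (fun k => L ^ k) atTop (nhds 0) := by
  refine tendsto_zero_of_opNorm (squeeze_zero (fun k => opNorm_nonneg _) h.opNorm_pow_le ?_)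
  simpa using (tendsto_mul_rate_pow h.one_le p).sqrt

lemma sylvester_iterate {X S L₁ L₂ : Matrix (Fin n) (Fin n) ℝ} (h : X = L₁ᵀ * X * L₂ + S) (N : ℕ) :
    X = (L₁ ^ N)ᵀ * X * L₂ ^ N + ∑ k ∈ Finset.range N, (L₁ ^ k)ᵀ * S * L₂ ^ k := by
  induction N with
  | zero => simp
  | succ N ih =>
    rw [Finset.sum_range_succ, pow_succ' L₁, pow_succ' L₂, transpose_mul]
    have h1 : (L₁ ^ N)ᵀ * X * L₂ ^ N = (L₁ ^ N)ᵀ * (L₁ᵀ * X * L₂ + S) * L₂ ^ N := by rw [← h]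
    conv_lhs => rw [ih, h1]
    simp only [Matrix.mul_add, Matrix.add_mul, Matrix.mul_assoc]
    abel

/-- Solutions of the Sylvester equation `X = L₁ᵀ X L₂ + S` are bounded by the inhomogeneity. -/
lemma circNorm_le_of_sylvester (ν : MatNorm) {P₁ P₂ X S L₁ L₂ : Matrix (Fin n) (Fin n) ℝ} {p s : ℝ}
    (h₁ : IsLyapunov P₁ L₁ p) (h₂ : IsLyapunov P₂ L₂ p) (h : X = L₁ᵀ * X * L₂ + S)
    (hS : circNorm ν S ≤ s) : circNorm ν X ≤ p ^ 2 * s := by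
  have hp := h₁.one_le
  have hs : 0 ≤ s := (circNorm_nonneg ν S).trans hS
  -- Each side contributes `√(p r^k)`, with product `p r^k`; summing the geometric series supplies
  -- the second factor `p`.
  have key (k : ℕ) {Z : Matrix (Fin n) (Fin n) ℝ} {z : ℝ} (hZ : circNorm ν Z ≤ z) :
      circNorm ν ((L₁ ^ k)ᵀ * Z * L₂ ^ k) ≤ p * rate p ^ k * z := by
    have hr := pow_nonneg (rate_nonneg hp) k
    have h3 := circNorm_mul_le_of_right (circNorm_mul_le_of_left
      (circNorm_transpose_le (ν := .op) (h₁.opNorm_pow_le k)) hZ) (h₂.opNorm_pow_le k)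
    refine h3.trans (le_of_eq ?_)
    rw [mul_right_comm, Real.mul_self_sqrt (by positivity)]
  have hsum (N : ℕ) : circNorm ν (∑ k ∈ Finset.range N, (L₁ ^ k)ᵀ * S * L₂ ^ k) ≤
      ∑ k ∈ Finset.range N, p * rate p ^ k * s := by
    induction N with
    | zero => simp [(circNorm_eq_zero ν).2 rfl]
    | succ N ih =>
      rw [Finset.sum_range_succ, Finset.sum_range_succ]
      exact circNorm_add_le ih (key N hS)
  have hN (N : ℕ) : circNorm ν X ≤ p * circNorm ν X * rate p ^ N + p ^ 2 * s := by
    conv_lhs => rw [sylvester_iterate h N]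
    refine (circNorm_add_le (key N le_rfl) (hsum N)).trans ?_
    rw [← Finset.sum_mul, ← Finset.mul_sum]
    have h4 : p * (∑ k ∈ Finset.range N, rate p ^ k) * s ≤ p * p * s := by
      gcongr
      exact mul_sum_rate_le hp N
    nlinarith
  refine ge_of_tendsto' (x := atTop) (f := fun N => _) ?_ hN
  simpa using (tendsto_mul_rate_pow hp (p * circNorm ν X)).add_const (p ^ 2 * s)

/-- The discrete Lyapunov equation is solvable for stable `L`. -/
lemma exists_lyapunov_solution {P L : Matrix (Fin n) (Fin n) ℝ} {p : ℝ} (h : IsLyapunov P L p)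
    (S : Matrix (Fin n) (Fin n) ℝ) : ∃ X, X = Lᵀ * X * L + S := by
  let f : Matrix (Fin n) (Fin n) ℝ →ₗ[ℝ] Matrix (Fin n) (Fin n) ℝ :=
    { toFun := fun X => X - Lᵀ * X * L
      map_add' := fun X Y => by
        simp only [Matrix.mul_add, Matrix.add_mul]
        abel
      map_smul' := fun a X => by
        simp [smul_sub] }
  -- The a priori bound with zero inhomogeneity gives injectivity; in finite dimension surjectivity
  -- follows.
  have hf : Function.Injective f := by
    rw [injective_iff_map_eq_zero]
    intro X hX
    have hX' : X = Lᵀ * X * L + 0 := by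
      rw [add_zero]
      exact sub_eq_zero.1 hX
    have := circNorm_le_of_sylvester .op h h hX' ((circNorm_eq_zero .op).2 rfl).le
    rw [mul_zero] at this
    exact (circNorm_eq_zero .op).1 (this.antisymm (circNorm_nonneg _ _))
  obtain ⟨X, hX⟩ := LinearMap.injective_iff_surjective.1 hf S
  exact ⟨X, by rw [← hX]; simp [f]⟩

end Lyapunov

/-! ### Spectral radius below one, vanishing powers, and Lyapunov functions. -/

section Stability

variable {n : ℕ}

lemma tendsto_matrix_iff {R : Type*} [TopologicalSpace R] {u : ℕ → Matrix (Fin n) (Fin n) R}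
    {a : Matrix (Fin n) (Fin n) R} :
    Tendsto u atTop (nhds a) ↔ ∀ i j, Tendsto (fun k => u k i j) atTop (nhds (a i j)) :=
  (tendsto_pi_nhds (f := fun k i => u k i) (g := fun i => a i)).trans
    (forall_congr' fun _ => tendsto_pi_nhds)

lemma tendsto_pow_iff_map (L : Matrix (Fin n) (Fin n) ℝ) :
    Tendsto (fun k => L ^ k) atTop (nhds 0) ↔
      Tendsto (fun k => L.map (algebraMap ℝ ℂ) ^ k) atTop (nhds 0) := by
  have h (k : ℕ) (i j) : (L.map (algebraMap ℝ ℂ) ^ k) i j = (((L ^ k) i j : ℝ) : ℂ) := by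
    rw [← Matrix.map_pow]
    rfl
  simp only [tendsto_matrix_iff, h, Matrix.zero_apply]
  refine forall_congr' fun i => forall_congr' fun j => ?_
  rw [← Complex.ofReal_zero]
  exact (Complex.isUniformEmbedding_ofReal.isEmbedding.tendsto_nhds_iff).trans Iff.rfl

section

open scoped Matrix.Norms.L2Operator

lemma spectralRadius_lt_one_of_tendsto_pow {a : Matrix (Fin n) (Fin n) ℂ}
    (h : Tendsto (fun k => a ^ k) atTop (nhds 0)) : spectralRadius ℂ a < 1 := by
  rcases subsingleton_or_nontrivial (Matrix (Fin n) (Fin n) ℂ) with hs | hs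
  · rw [Subsingleton.elim a 0, spectrum.spectralRadius_zero]
    exact one_pos
  have h1 : Tendsto (fun k => ‖a ^ k‖) atTop (nhds 0) := by simpa using h.norm
  obtain ⟨k, hk, hk0⟩ := ((h1.eventually_lt_const one_pos).and (eventually_ne_atTop 0)).exists
  have h2 := (spectrum.spectralRadius_pow_le (𝕜 := ℂ) a k hk0).trans
    (spectrum.spectralRadius_le_nnnorm (a ^ k))
  have h3 : (‖a ^ k‖₊ : ENNReal) < 1 := by exact_mod_cast hk
  by_contra! h4
  exact absurd (h2.trans_lt h3) (not_lt.2 (one_le_pow₀ h4))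

/-- Gelfand's formula: eventually `‖a ^ k‖ < r ^ k` for some `r` between the spectral radius and 1.
-/
lemma tendsto_pow_of_spectralRadius_lt_one {a : Matrix (Fin n) (Fin n) ℂ}
    (h : spectralRadius ℂ a < 1) : Tendsto (fun k => a ^ k) atTop (nhds 0) := by
  obtain ⟨r, hr, hr1⟩ := ENNReal.lt_iff_exists_nnreal_btwn.1 h
  have h1 := (spectrum.pow_nnnorm_pow_one_div_tendsto_nhds_spectralRadius a).eventually_lt_const hr
  rw [tendsto_zero_iff_norm_tendsto_zero]
  have hr1' : (r : ℝ) < 1 := by exact_mod_cast hr1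
  refine squeeze_zero' (Eventually.of_forall fun _ => norm_nonneg _) ?_
    (tendsto_pow_atTop_nhds_zero_of_lt_one r.2 hr1')
  filter_upwards [h1, eventually_ne_atTop 0] with k hk hk0
  have h2 : (‖a ^ k‖₊ : ENNReal) < (r : ENNReal) ^ k := by
    have := ENNReal.rpow_lt_rpow hk (z := k) (by positivity)
    rwa [← ENNReal.rpow_mul, one_div_mul_cancel (by exact_mod_cast hk0), ENNReal.rpow_one,
      ENNReal.rpow_natCast] at this
  have h3 : ‖a ^ k‖₊ < r ^ k := by exact_mod_cast h2
  exact_mod_cast h3.le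

end

lemma stable_iff_tendsto_pow (L : Matrix (Fin n) (Fin n) ℝ) :
    Stable L ↔ Tendsto (fun k => L ^ k) atTop (nhds 0) := by
  rw [tendsto_pow_iff_map]
  exact ⟨tendsto_pow_of_spectralRadius_lt_one, spectralRadius_lt_one_of_tendsto_pow⟩

/-- A stable matrix admits a Lyapunov function with prescribed decrease `Q ≥ 1`. -/
lemma Stable.exists_lyapunov {L Q : Matrix (Fin n) (Fin n) ℝ} (hL : Stable L)
    (hQ : Q.PosSemidef) (hQ1 : ∀ x, x ⬝ᵥ x ≤ qf Q x) :
    ∃ P : Matrix (Fin n) (Fin n) ℝ, P.PosSemidef ∧ ∀ x, qf P (L *ᵥ x) + qf Q x ≤ qf P x := by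
  have h0 := tendsto_opNorm_zero ((stable_iff_tendsto_pow L).1 hL)
  have h1 : Tendsto (fun k => opNorm Q * opNorm (L ^ k) ^ 2) atTop (nhds 0) := by
    simpa using (h0.pow 2).const_mul (opNorm Q)
  obtain ⟨N, hN⟩ := (h1.eventually_lt_const (show (0 : ℝ) < 1 / 2 by norm_num)).exists
  have hq (N : ℕ) (x) : qf (∑ k ∈ Finset.range N, (L ^ k)ᵀ * Q * L ^ k) x =
      ∑ k ∈ Finset.range N, qf Q ((L ^ k) *ᵥ x) := by
    induction N with
    | zero => simp [qf_zero]
    | succ N ih => rw [Finset.sum_range_succ, Finset.sum_range_succ, qf_add, ih, qf_conj]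
  have hsd (N : ℕ) : (∑ k ∈ Finset.range N, (L ^ k)ᵀ * Q * L ^ k).PosSemidef := by
    refine posSemidef_of_qf ?_ fun x => ?_
    · simp [transpose_sum, transpose_mul, transpose_eq_of_posSemidef hQ, Matrix.mul_assoc]
    · rw [hq]
      exact Finset.sum_nonneg fun k _ => qf_nonneg hQ _
  -- The truncated sum `S` satisfies `S(Lx) + Q(x) = S(x) + Q(L^N x)`, and `Q(L^N x) ≤ Q(x)/2` for
  -- the chosen `N`; doubling `S` absorbs this defect, so no infinite series is needed.
  refine ⟨(2 : ℝ) • ∑ k ∈ Finset.range N, (L ^ k)ᵀ * Q * L ^ k,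
    (hsd N).smul (by norm_num), fun x => ?_⟩
  have h2 : qf Q ((L ^ N) *ᵥ x) ≤ 1 / 2 * qf Q x := by
    have h3 := qf_le Q ((L ^ N) *ᵥ x)
    have h4 := mul_le_mul_of_nonneg_left (dot_mulVec_le (L ^ N) x) (opNorm_nonneg Q)
    have h5 := mul_le_mul_of_nonneg_right hN.le (dot_self_nonneg x)
    have h6 := hQ1 x
    linarith
  have h7 := Finset.sum_range_succ (fun k => qf Q ((L ^ k) *ᵥ x)) N
  rw [Finset.sum_range_succ'] at h7
  simp only [pow_zero, one_mulVec] at h7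
  rw [qf_smul, qf_smul, hq, hq]
  simp only [mulVec_mulVec, ← pow_succ]
  linarith

end Stability

/-! ### The Riccati operator as a minimum of one-step costs. -/

section Riccati

variable {n m : ℕ}

/-- The matrix `1 + Bᵀ P B`. -/
def inputWeight (B : Matrix (Fin n) (Fin m) ℝ) (P : Matrix (Fin n) (Fin n) ℝ) :
    Matrix (Fin m) (Fin m) ℝ := 1 + Bᵀ * P * B

/-- The minimizing controller for the cost-to-go `P`. -/
noncomputable def gain (A : Matrix (Fin n) (Fin n) ℝ) (B : Matrix (Fin n) (Fin m) ℝ)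
    (P : Matrix (Fin n) (Fin n) ℝ) : Matrix (Fin m) (Fin n) ℝ :=
  -((1 + Bᵀ * P * B)⁻¹ * Bᵀ * P * A)

/-- The Riccati operator. -/
noncomputable def riccati (Rx A : Matrix (Fin n) (Fin n) ℝ) (B : Matrix (Fin n) (Fin m) ℝ)
    (P : Matrix (Fin n) (Fin n) ℝ) : Matrix (Fin n) (Fin n) ℝ :=
  Aᵀ * P * A - Aᵀ * P * B * (1 + Bᵀ * P * B)⁻¹ * Bᵀ * P * A + Rx

/-- The one-step cost of the controller `K` with cost-to-go `P`. -/
def stepCost (Rx A : Matrix (Fin n) (Fin n) ℝ) (B : Matrix (Fin n) (Fin m) ℝ)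
    (K : Matrix (Fin m) (Fin n) ℝ) (P : Matrix (Fin n) (Fin n) ℝ) : Matrix (Fin n) (Fin n) ℝ :=
  (A + B * K)ᵀ * P * (A + B * K) + Kᵀ * K + Rx

lemma posDef_inputWeight (B : Matrix (Fin n) (Fin m) ℝ) {P : Matrix (Fin n) (Fin n) ℝ}
    (hP : P.PosSemidef) : (inputWeight B P).PosDef := by
  refine PosDef.one.add_posSemidef ?_
  simpa [conjTranspose_eq_transpose_of_trivial] using hP.conjTranspose_mul_mul_same B

lemma isUnit_det_inputWeight (B : Matrix (Fin n) (Fin m) ℝ) {P : Matrix (Fin n) (Fin n) ℝ}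
    (hP : P.PosSemidef) : IsUnit (inputWeight B P).det :=
  (posDef_inputWeight B hP).det_pos.ne'.isUnit

lemma inputWeight_transpose (B : Matrix (Fin n) (Fin m) ℝ) {P : Matrix (Fin n) (Fin n) ℝ}
    (hP : Pᵀ = P) : (inputWeight B P)ᵀ = inputWeight B P := by
  simp [inputWeight, transpose_mul, hP, Matrix.mul_assoc]

lemma inputWeight_mul_gain (A : Matrix (Fin n) (Fin n) ℝ) (B : Matrix (Fin n) (Fin m) ℝ)
    {P : Matrix (Fin n) (Fin n) ℝ} (hP : P.PosSemidef) :
    inputWeight B P * gain A B P = -(Bᵀ * P * A) := by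
  have h := mul_nonsing_inv _ (isUnit_det_inputWeight B hP)
  unfold inputWeight at h
  rw [gain, inputWeight, Matrix.mul_neg, ← Matrix.mul_assoc, ← Matrix.mul_assoc,
    ← Matrix.mul_assoc, h, Matrix.one_mul]

/-- The gain satisfies `K = -Bᵀ P (A + B K)`. -/
lemma gain_eq (A : Matrix (Fin n) (Fin n) ℝ) (B : Matrix (Fin n) (Fin m) ℝ)
    {P : Matrix (Fin n) (Fin n) ℝ} (hP : P.PosSemidef) :
    gain A B P = -(Bᵀ * P * (A + B * gain A B P)) := by
  have h := inputWeight_mul_gain A B hP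
  rw [inputWeight, Matrix.add_mul, Matrix.one_mul] at h
  rw [Matrix.mul_add, ← Matrix.mul_assoc, neg_add, ← h]
  abel

/-- Completion of squares. -/
lemma stepCost_eq (Rx A : Matrix (Fin n) (Fin n) ℝ) (B : Matrix (Fin n) (Fin m) ℝ)
    (K : Matrix (Fin m) (Fin n) ℝ) {P : Matrix (Fin n) (Fin n) ℝ} (hP : P.PosSemidef) :
    stepCost Rx A B K P = riccati Rx A B P +
      (K - gain A B P)ᵀ * inputWeight B P * (K - gain A B P) := by
  have hs := transpose_eq_of_posSemidef hP
  have h1 := inputWeight_mul_gain A B hP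
  have h2 : (gain A B P)ᵀ * inputWeight B P = -(Aᵀ * P * B) := by
    have := congrArg transpose h1
    rw [transpose_mul, inputWeight_transpose B hs] at this
    simpa [transpose_mul, hs, Matrix.mul_assoc] using this
  have h3 : riccati Rx A B P = Aᵀ * P * A + Aᵀ * P * B * gain A B P + Rx := by
    simp only [riccati, gain, Matrix.mul_neg, Matrix.mul_assoc, sub_eq_add_neg]
  have h4 : (K - gain A B P)ᵀ * inputWeight B P * (K - gain A B P) =
      Kᵀ * inputWeight B P * K + Kᵀ * (Bᵀ * P * A) + Aᵀ * P * B * K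
        - Aᵀ * P * B * gain A B P := by
    rw [transpose_sub, Matrix.sub_mul, h2, Matrix.mul_sub, Matrix.sub_mul, Matrix.sub_mul,
      Matrix.mul_assoc Kᵀ _ (gain A B P), h1]
    simp only [Matrix.mul_neg, Matrix.neg_mul]
    abel
  rw [h3, h4]
  simp only [stepCost, inputWeight, transpose_add, transpose_mul, Matrix.mul_add, Matrix.add_mul,
    Matrix.mul_assoc, Matrix.mul_one]
  abel

lemma riccati_eq_stepCost (Rx A : Matrix (Fin n) (Fin n) ℝ) (B : Matrix (Fin n) (Fin m) ℝ)
    {P : Matrix (Fin n) (Fin n) ℝ} (hP : P.PosSemidef) :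
    riccati Rx A B P = stepCost Rx A B (gain A B P) P := by
  rw [stepCost_eq Rx A B _ hP]
  simp

lemma qf_stepCost (Rx A : Matrix (Fin n) (Fin n) ℝ) (B : Matrix (Fin n) (Fin m) ℝ)
    (K : Matrix (Fin m) (Fin n) ℝ) (P : Matrix (Fin n) (Fin n) ℝ) (x : Fin n → ℝ) :
    qf (stepCost Rx A B K P) x = qf P ((A + B * K) *ᵥ x) + qf (Kᵀ * K) x + qf Rx x := by
  rw [stepCost, qf_add, qf_add, qf_conj]

lemma riccati_le_stepCost (Rx A : Matrix (Fin n) (Fin n) ℝ) (B : Matrix (Fin n) (Fin m) ℝ)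
    (K : Matrix (Fin m) (Fin n) ℝ) {P : Matrix (Fin n) (Fin n) ℝ} (hP : P.PosSemidef)
    (x : Fin n → ℝ) : qf (riccati Rx A B P) x ≤ qf (stepCost Rx A B K P) x := by
  rw [stepCost_eq Rx A B K hP, qf_add, qf_conj]
  have := qf_nonneg (posDef_inputWeight B hP).posSemidef ((K - gain A B P) *ᵥ x)
  linarith

lemma stepCost_mono (Rx A : Matrix (Fin n) (Fin n) ℝ) (B : Matrix (Fin n) (Fin m) ℝ)
    (K : Matrix (Fin m) (Fin n) ℝ) {P Q : Matrix (Fin n) (Fin n) ℝ}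
    (h : ∀ x, qf P x ≤ qf Q x) (x : Fin n → ℝ) :
    qf (stepCost Rx A B K P) x ≤ qf (stepCost Rx A B K Q) x := by
  rw [qf_stepCost, qf_stepCost]
  linarith [h ((A + B * K) *ᵥ x)]

/-- The Riccati operator is the minimum over controllers of monotone maps: use the minimizer for `Q`
as a competitor for `P`. -/
lemma riccati_mono (Rx A : Matrix (Fin n) (Fin n) ℝ) (B : Matrix (Fin n) (Fin m) ℝ)
    {P Q : Matrix (Fin n) (Fin n) ℝ} (hP : P.PosSemidef) (hQ : Q.PosSemidef)
    (h : ∀ x, qf P x ≤ qf Q x) (x : Fin n → ℝ) :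
    qf (riccati Rx A B P) x ≤ qf (riccati Rx A B Q) x := by
  rw [riccati_eq_stepCost Rx A B hQ]
  exact (riccati_le_stepCost Rx A B _ hP x).trans (stepCost_mono Rx A B _ h x)

lemma posSemidef_stepCost {Rx : Matrix (Fin n) (Fin n) ℝ} (hR : Rx.PosSemidef)
    (A : Matrix (Fin n) (Fin n) ℝ) (B : Matrix (Fin n) (Fin m) ℝ)
    (K : Matrix (Fin m) (Fin n) ℝ) {P : Matrix (Fin n) (Fin n) ℝ} (hP : P.PosSemidef) :
    (stepCost Rx A B K P).PosSemidef := by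
  have h1 := hP.conjTranspose_mul_mul_same (A + B * K)
  have h2 := posSemidef_conjTranspose_mul_self K
  rw [conjTranspose_eq_transpose_of_trivial] at h1 h2
  exact (h1.add h2).add hR

lemma posSemidef_riccati {Rx : Matrix (Fin n) (Fin n) ℝ} (hR : Rx.PosSemidef)
    (A : Matrix (Fin n) (Fin n) ℝ) (B : Matrix (Fin n) (Fin m) ℝ)
    {P : Matrix (Fin n) (Fin n) ℝ} (hP : P.PosSemidef) : (riccati Rx A B P).PosSemidef := by
  rw [riccati_eq_stepCost Rx A B hP]
  exact posSemidef_stepCost hR A B _ hP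

lemma continuousAt_riccati (Rx A : Matrix (Fin n) (Fin n) ℝ) (B : Matrix (Fin n) (Fin m) ℝ)
    {P : Matrix (Fin n) (Fin n) ℝ} (hP : P.PosSemidef) : ContinuousAt (riccati Rx A B) P := by
  have h1 : Continuous fun Q : Matrix (Fin n) (Fin n) ℝ => 1 + Bᵀ * Q * B := by fun_prop
  have h2 : ContinuousAt (fun Q : Matrix (Fin n) (Fin n) ℝ => (1 + Bᵀ * Q * B)⁻¹) P := by
    refine ContinuousAt.comp (g := fun X : Matrix (Fin m) (Fin m) ℝ => X⁻¹)
      (continuousAt_matrix_inv _ ?_) h1.continuousAt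
    have := (posDef_inputWeight B hP).det_pos.ne'
    exact NormedRing.inverse_continuousAt (Units.mk0 _ this)
  unfold riccati
  fun_prop

/-- Polarization, used to pass from convergence of quadratic forms to convergence of entries. -/
lemma apply_eq_qf {P : Matrix (Fin n) (Fin n) ℝ} (hP : Pᵀ = P) (i j : Fin n) :
    P i j = (qf P (Pi.single i 1 + Pi.single j 1) - qf P (Pi.single i 1) -
      qf P (Pi.single j 1)) / 2 := by
  have : P j i = P i j := by
    conv_lhs => rw [← hP]
    rfl
  simp [qf, mulVec_add, add_dotProduct, dotProduct_add, this]
  ring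

lemma continuous_qf (x : Fin n → ℝ) : Continuous fun P : Matrix (Fin n) (Fin n) ℝ => qf P x := by
  unfold qf
  fun_prop

/-- Bounded monotone sequences of positive semidefinite matrices converge. -/
lemma exists_tendsto_of_monotone {u : ℕ → Matrix (Fin n) (Fin n) ℝ} {Q : Matrix (Fin n) (Fin n) ℝ}
    (hu : ∀ k, (u k).PosSemidef) (hmono : ∀ k x, qf (u k) x ≤ qf (u (k + 1)) x)
    (hQ : ∀ k x, qf (u k) x ≤ qf Q x) :
    ∃ P, P.PosSemidef ∧ Tendsto u atTop (nhds P) ∧ ∀ x, qf P x ≤ qf Q x := by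
  have hconv (x : Fin n → ℝ) : ∃ a, Tendsto (fun k => qf (u k) x) atTop (nhds a) :=
    ⟨_, tendsto_atTop_ciSup (monotone_nat_of_le_succ fun k => hmono k x)
      ⟨qf Q x, by rintro _ ⟨k, rfl⟩; exact hQ k x⟩⟩
  choose a ha using hconv
  have hent (i j : Fin n) : ∃ b, Tendsto (fun k => u k i j) atTop (nhds b) := by
    refine ⟨_, Tendsto.congr (fun k => (apply_eq_qf (transpose_eq_of_posSemidef (hu k)) i j).symm)
      ((((ha (Pi.single i 1 + Pi.single j 1)).sub (ha (Pi.single i 1))).sub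
        (ha (Pi.single j 1))).div_const 2)⟩
  choose b hb using hent
  have hlim : Tendsto u atTop (nhds (Matrix.of b)) := tendsto_matrix_iff.2 hb
  have hq (x) : Tendsto (fun k => qf (u k) x) atTop (nhds (qf (Matrix.of b) x)) :=
    ((continuous_qf x).tendsto _).comp hlim
  refine ⟨Matrix.of b, posSemidef_of_qf ?_ fun x => ?_, hlim, fun x => ?_⟩
  · refine tendsto_nhds_unique (((continuous_id.matrix_transpose).tendsto _).comp hlim) ?_
    simpa [Function.comp_def, fun k => transpose_eq_of_posSemidef (hu k)] using hlim
  · exact ge_of_tendsto' (hq x) fun k => qf_nonneg (hu k) x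
  · exact le_of_tendsto' (hq x) fun k => hQ k x

/-- A positive semidefinite supersolution for some controller yields a solution of the Riccati
equation. -/
lemma exists_riccati_fixedPoint {Rx A Q : Matrix (Fin n) (Fin n) ℝ} {B : Matrix (Fin n) (Fin m) ℝ}
    {K : Matrix (Fin m) (Fin n) ℝ} (hR : Rx.PosSemidef) (hQ : Q.PosSemidef)
    (h : ∀ x, qf (stepCost Rx A B K Q) x ≤ qf Q x) :
    ∃ P, P.PosSemidef ∧ P = riccati Rx A B P := by
  -- Value iteration from 0: increasing by monotonicity, bounded by the supersolution `Q`, and its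
  -- limit is a fixed point by continuity.
  let u : ℕ → Matrix (Fin n) (Fin n) ℝ := fun k => (riccati Rx A B)^[k] 0
  have hsucc (k) : u (k + 1) = riccati Rx A B (u k) := Function.iterate_succ_apply' _ _ _
  have hu (k) : (u k).PosSemidef := by
    induction k with
    | zero => exact PosSemidef.zero
    | succ k ih => rw [hsucc]; exact posSemidef_riccati hR A B ih
  have hmono (k) : ∀ x, qf (u k) x ≤ qf (u (k + 1)) x := by
    induction k with
    | zero =>
      intro x
      change qf 0 x ≤ _
      rw [qf_zero]
      exact qf_nonneg (hu 1) x
    | succ k ih =>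
      rw [hsucc, hsucc (k + 1)]
      exact riccati_mono Rx A B (hu k) (hu (k + 1)) ih
  have hbound (k) : ∀ x, qf (u k) x ≤ qf Q x := by
    induction k with
    | zero =>
      intro x
      change qf 0 x ≤ _
      rw [qf_zero]
      exact qf_nonneg hQ x
    | succ k ih =>
      intro x
      rw [hsucc]
      exact (riccati_le_stepCost Rx A B K (hu k) x).trans ((stepCost_mono Rx A B K ih x).trans (h x))
  obtain ⟨P, hP, hlim, -⟩ := exists_tendsto_of_monotone hu hmono hbound
  refine ⟨P, hP, tendsto_nhds_unique ((tendsto_add_atTop_iff_nat 1).2 hlim) ?_⟩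
  simp only [hsucc]
  exact (continuousAt_riccati Rx A B hP).tendsto.comp hlim

/-- Solutions of the Riccati equation lie below supersolutions of stabilizing controllers. -/
lemma riccati_fixedPoint_le {Rx A P Q : Matrix (Fin n) (Fin n) ℝ} {B : Matrix (Fin n) (Fin m) ℝ}
    {K : Matrix (Fin m) (Fin n) ℝ} (hP : P.PosSemidef) (hfix : P = riccati Rx A B P)
    (hK : Tendsto (fun k => (A + B * K) ^ k) atTop (nhds 0))
    (h : ∀ x, qf (stepCost Rx A B K Q) x ≤ qf Q x) (x : Fin n → ℝ) : qf P x ≤ qf Q x := by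
  -- The gap `P - Q` cannot decrease along trajectories of the stable closed loop, yet tends to 0
  -- there, so it is nonpositive at the start.
  have hstep (y) : qf (P - Q) y ≤ qf (P - Q) ((A + B * K) *ᵥ y) := by
    have h1 := riccati_le_stepCost Rx A B K hP y
    have h2 := h y
    rw [← hfix, qf_stepCost] at h1
    rw [qf_stepCost] at h2
    rw [qf_sub, qf_sub]
    linarith
  have hiter (k : ℕ) : qf (P - Q) x ≤ qf (P - Q) (((A + B * K) ^ k) *ᵥ x) := by
    induction k with
    | zero => simp
    | succ k ih =>
      rw [pow_succ', ← mulVec_mulVec]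
      exact ih.trans (hstep _)
  have hlim : Tendsto (fun k => qf (P - Q) (((A + B * K) ^ k) *ᵥ x)) atTop (nhds 0) := by
    have hc : Continuous fun X : Matrix (Fin n) (Fin n) ℝ => qf (P - Q) (X *ᵥ x) := by
      unfold qf
      fun_prop
    simpa [qf, Function.comp_def] using (hc.tendsto 0).comp hK
  have := ge_of_tendsto' hlim hiter
  rw [qf_sub] at this
  linarith

end Riccati

/-! ### Bounds for the optimal closed loop. -/

section ClosedLoop

variable {n m : ℕ}

/-- The relations and bounds satisfied by a solution `P` of the Riccati equation, its gain `K`,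
its closed loop matrix `L` and the inverse `N` of `1 + Bᵀ P B`. -/
structure IsClosedLoop (Rx A : Matrix (Fin n) (Fin n) ℝ) (B : Matrix (Fin n) (Fin m) ℝ)
    (P : Matrix (Fin n) (Fin n) ℝ) (K : Matrix (Fin m) (Fin n) ℝ)
    (L : Matrix (Fin n) (Fin n) ℝ) (N : Matrix (Fin m) (Fin m) ℝ) (p : ℝ) : Prop where
  symm : Pᵀ = P
  closed : L = A + B * K
  gain : K = -(Bᵀ * P * L)
  cost : P = Lᵀ * P * L + Kᵀ * K + Rx
  mul_inv : inputWeight B P * N = 1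
  inv_mul : N * inputWeight B P = 1
  inv_symm : Nᵀ = N
  lyap : IsLyapunov P L p
  norm_P : circNorm .op P ≤ p
  norm_K : circNorm .op K ≤ p
  norm_L : circNorm .op L ≤ p
  norm_inv : circNorm .op N ≤ 1
  norm_inv_mul : circNorm .op (N * Bᵀ) ≤ 1
  norm_mul_inv_mul : circNorm .op (B * N * Bᵀ) ≤ 1

lemma dot_le_half (x y : Fin n → ℝ) : x ⬝ᵥ y ≤ (x ⬝ᵥ x + y ⬝ᵥ y) / 2 := by
  have h := dot_self_nonneg (x - y)
  rw [sub_dotProduct, dotProduct_sub, dotProduct_sub, dotProduct_comm y x] at h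
  linarith

/-- Keeping the term `|Bx|²` is what makes the later bounds independent of the size of `B`. -/
lemma qf_inputWeight_ge {B : Matrix (Fin n) (Fin m) ℝ} {P : Matrix (Fin n) (Fin n) ℝ}
    (hP : ∀ x, x ⬝ᵥ x ≤ qf P x) (x : Fin m → ℝ) :
    x ⬝ᵥ x + (B *ᵥ x) ⬝ᵥ (B *ᵥ x) ≤ qf (inputWeight B P) x := by
  rw [inputWeight, qf_add, qf_one, qf_conj]
  linarith [hP (B *ᵥ x)]

lemma one_le_of_posSemidef_sub_one {R : Matrix (Fin n) (Fin n) ℝ} (hR : (R - 1).PosSemidef)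
    (x : Fin n → ℝ) : x ⬝ᵥ x ≤ qf R x := by
  have := qf_nonneg hR x
  rw [qf_sub, qf_one] at this
  linarith

lemma posSemidef_of_sub_one {R : Matrix (Fin n) (Fin n) ℝ} (hR : (R - 1).PosSemidef) :
    R.PosSemidef := by
  simpa using hR.add PosSemidef.one

lemma qf_transpose_mul_self_nonneg (C : Matrix (Fin m) (Fin n) ℝ) (x : Fin n → ℝ) :
    0 ≤ qf (Cᵀ * C) x := by
  rw [qf_transpose_mul_self]
  exact dot_self_nonneg _

variable {Rx A P : Matrix (Fin n) (Fin n) ℝ} {B : Matrix (Fin n) (Fin m) ℝ} {p : ℝ}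

lemma IsDARESolution.eq_stepCost (h : IsDARESolution Rx 1 A B P) :
    P = stepCost Rx A B (LQR.gain A B P) P :=
  (show P = riccati Rx A B P from h.2).trans (riccati_eq_stepCost Rx A B h.1)

lemma IsDARESolution.qf_eq (h : IsDARESolution Rx 1 A B P) (x : Fin n → ℝ) :
    qf P x = qf P ((A + B * LQR.gain A B P) *ᵥ x) +
      qf ((LQR.gain A B P)ᵀ * LQR.gain A B P) x + qf Rx x := by
  conv_lhs => rw [h.eq_stepCost]
  rw [qf_stepCost]

/-- Here `p` is any upper bound for `‖P‖`, at least 1, so that nominal and perturbed systems can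
share it. -/
lemma IsDARESolution.isClosedLoop (hR : (Rx - 1).PosSemidef) (h : IsDARESolution Rx 1 A B P)
    (hp : 1 ≤ p) (hPp : opNorm P ≤ p) :
    IsClosedLoop Rx A B P (LQR.gain A B P) (A + B * LQR.gain A B P) (inputWeight B P)⁻¹ p := by
  have hu := isUnit_det_inputWeight B h.1
  have hs := transpose_eq_of_posSemidef h.1
  have hR1 := one_le_of_posSemidef_sub_one hR
  set K := LQR.gain A B P
  set N := (inputWeight B P)⁻¹ with hN
  have hMN : inputWeight B P * N = 1 := mul_nonsing_inv _ hu
  have hNM : N * inputWeight B P = 1 := nonsing_inv_mul _ hu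
  have hq (x) : qf P x = qf P ((A + B * K) *ᵥ x) + qf (Kᵀ * K) x + qf Rx x := h.qf_eq x
  have hKK := qf_transpose_mul_self_nonneg K
  have hlow (x) : x ⬝ᵥ x ≤ qf P x := by
    linarith [hq x, hKK x, hR1 x, qf_nonneg h.1 ((A + B * K) *ᵥ x)]
  have hup (x) : qf P x ≤ p * (x ⬝ᵥ x) :=
    (qf_le P x).trans (mul_le_mul_of_nonneg_right hPp (dot_self_nonneg x))
  have hup2 (x : Fin n → ℝ) : qf P x ≤ p ^ 2 * (x ⬝ᵥ x) :=
    (hup x).trans (mul_le_mul_of_nonneg_right (by nlinarith) (dot_self_nonneg x))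
  have hNT : Nᵀ = N := by rw [hN, transpose_nonsing_inv, inputWeight_transpose B hs]
  -- For `z = N y` this reads `|z|² + |Bz|² ≤ z · y`. With `z · y ≤ (|z|² + |y|²)/2` it bounds both
  -- `N` and `B N`; for `y = Bᵀ w` the right side is `Bz · w`, which bounds `B N Bᵀ`.
  have hform (y : Fin m → ℝ) :
      (N *ᵥ y) ⬝ᵥ (N *ᵥ y) + (B *ᵥ (N *ᵥ y)) ⬝ᵥ (B *ᵥ (N *ᵥ y)) ≤ (N *ᵥ y) ⬝ᵥ y := by
    refine (qf_inputWeight_ge hlow (N *ᵥ y)).trans (le_of_eq ?_)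
    rw [qf, mulVec_mulVec, hMN, one_mulVec]
  have hBN : opNorm (B * N) ≤ 1 := by
    refine opNorm_le_of_dot_le _ zero_le_one fun y => ?_
    rw [← mulVec_mulVec]
    linarith [hform y, dot_le_half (N *ᵥ y) y, dot_self_nonneg (N *ᵥ y), dot_self_nonneg y]
  refine ⟨hs, rfl, gain_eq A B h.1, h.eq_stepCost, hMN, hNM, hNT, ⟨hp, hlow, hup, fun x => ?_⟩,
    hPp, ?_, ?_, ?_, ?_, ?_⟩
  · linarith [hq x, hKK x, hR1 x]
  · refine opNorm_le_of_transpose_mul_le (by linarith) fun x => ?_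
    linarith [hq x, hup2 x, hR1 x, qf_nonneg h.1 ((A + B * K) *ᵥ x), dot_self_nonneg x]
  · refine opNorm_le_of_dot_le _ (by linarith) fun x => ?_
    linarith [hq x, hup2 x, hR1 x, hlow ((A + B * K) *ᵥ x), hKK x, dot_self_nonneg x]
  · refine opNorm_le_of_dot_le _ zero_le_one fun y => ?_
    linarith [hform y, dot_le_half (N *ᵥ y) y, dot_self_nonneg (B *ᵥ (N *ᵥ y)), dot_self_nonneg y]
  · have := circNorm_transpose_le (ν := .op) hBN
    rwa [transpose_mul, hNT] at this
  · refine opNorm_le_of_dot_le _ zero_le_one fun w => ?_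
    have h1 := hform (Bᵀ *ᵥ w)
    rw [dotProduct_mulVec (N *ᵥ (Bᵀ *ᵥ w)) Bᵀ w, vecMul_transpose] at h1
    simp only [← mulVec_mulVec]
    linarith [dot_le_half (B *ᵥ (N *ᵥ (Bᵀ *ᵥ w))) w, dot_self_nonneg (N *ᵥ (Bᵀ *ᵥ w)),
      dot_self_nonneg w]

lemma IsDARESolution.one_le_opNorm [NeZero n] (hR : (Rx - 1).PosSemidef)
    (h : IsDARESolution Rx 1 A B P) : 1 ≤ opNorm P := by
  have h1 := one_le_of_posSemidef_sub_one hR (Pi.single 0 1)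
  have h2 := h.qf_eq (Pi.single 0 1)
  have h3 := qf_transpose_mul_self_nonneg (LQR.gain A B P) (Pi.single 0 1)
  have h4 := qf_nonneg h.1 ((A + B * LQR.gain A B P) *ᵥ (Pi.single 0 1))
  have h5 := qf_le P (Pi.single 0 1)
  simp only [single_dotProduct, Pi.single_eq_same, mul_one] at h1 h5
  linarith

end ClosedLoop

/-! ### Existence of a Riccati solution for stabilizable systems. -/

section Existence

variable {n m : ℕ} {Rx A : Matrix (Fin n) (Fin n) ℝ} {B : Matrix (Fin n) (Fin m) ℝ}

lemma Stabilizable.exists_isDARESolution (hR : (Rx - 1).PosSemidef) (h : Stabilizable A B) :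
    ∃ P, IsDARESolution Rx 1 A B P := by
  obtain ⟨K, hK⟩ := h
  have hRx := posSemidef_of_sub_one hR
  have hKK := posSemidef_conjTranspose_mul_self K
  rw [conjTranspose_eq_transpose_of_trivial] at hKK
  obtain ⟨Q, hQ, hQ'⟩ := hK.exists_lyapunov (hKK.add hRx) fun x => by
    rw [qf_add]
    linarith [one_le_of_posSemidef_sub_one hR x, qf_nonneg hKK x]
  refine exists_riccati_fixedPoint (K := K) hRx hQ fun x => ?_
  have := hQ' x
  rw [qf_add] at this
  rw [qf_stepCost]
  linarith

lemma isDARESolution_Pinf (h : ∃ P, IsDARESolution Rx 1 A B P) :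
    IsDARESolution Rx 1 A B (Pinf Rx 1 A B) := by
  unfold Pinf
  rw [dif_pos h]
  exact h.choose_spec

end Existence

/-! ### Stabilizability and cost bound for nearby systems. -/

section Perturbation

variable {n m : ℕ} {Rx A A' P : Matrix (Fin n) (Fin n) ℝ} {B B' : Matrix (Fin n) (Fin m) ℝ}
  {K : Matrix (Fin m) (Fin n) ℝ} {L : Matrix (Fin n) (Fin n) ℝ} {N : Matrix (Fin m) (Fin m) ℝ}
  {p e : ℝ}

lemma circNorm_closedLoop_perturbation_le {ν : MatNorm} (hp : 1 ≤ p)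
    (hA : circNorm ν (A' - A) ≤ e) (hB : circNorm ν (B' - B) ≤ e) (hK : circNorm .op K ≤ p) :
    circNorm ν (A' - A + (B' - B) * K) ≤ 2 * p * e := by
  have he : 0 ≤ e := (circNorm_nonneg _ _).trans hA
  refine (circNorm_add_le hA (circNorm_mul_le_of_right hB hK)).trans ?_
  nlinarith

/-- Twice the cost of the nominal system is a supersolution for the perturbed system. -/
lemma IsClosedLoop.perturbed_decrease (hR : ∀ x, x ⬝ᵥ x ≤ qf Rx x)
    (h : IsClosedLoop Rx A B P K L N p)
    (hA : circNorm .op (A' - A) ≤ e) (hB : circNorm .op (B' - B) ≤ e) (he : 54 * p ^ 5 * e ≤ 1)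
    (x : Fin n → ℝ) :
    qf (stepCost Rx A' B' K ((2 : ℝ) • P)) x ≤ qf ((2 : ℝ) • P) x := by
  have hp := h.lyap.one_le
  have he0 : 0 ≤ e := (circNorm_nonneg _ _).trans hA
  set D := A' - A + (B' - B) * K with hD
  have hDn : circNorm .op D ≤ 2 * p * e := circNorm_closedLoop_perturbation_le hp hA hB h.norm_K
  have hL' : A' + B' * K = L + D := by
    rw [hD, h.closed, Matrix.sub_mul]
    abel
  have hexp : (L + D)ᵀ * P * (L + D) = Lᵀ * P * L + (Lᵀ * P * D + Dᵀ * P * L + Dᵀ * P * D) := by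
    simp only [transpose_add, Matrix.add_mul, Matrix.mul_add]
    abel
  -- Doubling `P` leaves a slack of one copy of `KᵀK + Rx ≥ 1`, so the perturbation `Z` of `Lᵀ P L`
  -- must satisfy `2Z ≤ 1`. Its norm is at most `4p³e + 4p³e²`, well below 1/2 when `54 p⁵ e ≤ 1`.
  have hZ : circNorm .op (Lᵀ * P * D + Dᵀ * P * L + Dᵀ * P * D) ≤ 1 / 2 := by
    have hLT := circNorm_transpose_le h.norm_L
    have hDT := circNorm_transpose_le hDn
    refine (circNorm_add_le (circNorm_add_le
      (circNorm_mul_le_of_left (circNorm_mul_le_of_left hLT h.norm_P) hDn)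
      (circNorm_mul_le_of_left (circNorm_mul_le_of_left hDT h.norm_P) h.norm_L))
      (circNorm_mul_le_of_left (circNorm_mul_le_of_left hDT h.norm_P) hDn)).trans ?_
    have h1 : p ^ 3 * e ≤ p ^ 5 * e :=
      mul_le_mul_of_nonneg_right (pow_le_pow_right₀ hp (by norm_num)) he0
    have h2 : e ≤ p ^ 5 * e := le_mul_of_one_le_left he0 (one_le_pow₀ hp)
    have h3 : (p ^ 3 * e) * e ≤ 1 / 54 * (1 / 54) :=
      mul_le_mul (by linarith) (by linarith) he0 (by norm_num)
    nlinarith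
  have h1 := qf_le (Lᵀ * P * D + Dᵀ * P * L + Dᵀ * P * D) x
  have h2 := mul_le_mul_of_nonneg_right hZ (dot_self_nonneg x)
  have h3 : qf P x = qf P (L *ᵥ x) + qf (Kᵀ * K) x + qf Rx x := by
    conv_lhs => rw [h.cost]
    rw [qf_add, qf_add, qf_conj]
  have h4 := congrArg (fun X => qf X x) hexp
  simp only [qf_add _ (_ + _), qf_conj _ (L + D), qf_conj _ L] at h4
  rw [qf_stepCost, qf_smul, qf_smul, hL', h4, h3]
  have h5 := qf_transpose_mul_self_nonneg K x
  have h6 := hR x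
  change _ ≤ opNorm _ * _ at h1
  change opNorm _ * _ ≤ _ at h2
  linarith

lemma IsClosedLoop.isLyapunov_perturbed (hR : ∀ x, x ⬝ᵥ x ≤ qf Rx x)
    (h : IsClosedLoop Rx A B P K L N p)
    (hA : circNorm .op (A' - A) ≤ e) (hB : circNorm .op (B' - B) ≤ e) (he : 54 * p ^ 5 * e ≤ 1) :
    IsLyapunov ((2 : ℝ) • P) (A' + B' * K) (2 * p) := by
  have hp := h.lyap.one_le
  refine ⟨by linarith, fun x => ?_, fun x => ?_, fun x => ?_⟩
  · rw [qf_smul]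
    linarith [h.lyap.lower x, dot_self_nonneg x]
  · rw [qf_smul]
    linarith [h.lyap.upper x]
  · have h1 := h.perturbed_decrease hR hA hB he x
    rw [qf_stepCost] at h1
    linarith [hR x, qf_transpose_mul_self_nonneg K x]

lemma IsClosedLoop.stabilizable_perturbed (hR : ∀ x, x ⬝ᵥ x ≤ qf Rx x)
    (h : IsClosedLoop Rx A B P K L N p)
    (hA : circNorm .op (A' - A) ≤ e) (hB : circNorm .op (B' - B) ≤ e) (he : 54 * p ^ 5 * e ≤ 1) :
    Stabilizable A' B' :=
  ⟨K, (stable_iff_tendsto_pow _).2 (h.isLyapunov_perturbed hR hA hB he).tendsto_pow⟩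

/-- The optimal cost of the perturbed system lies below the supersolution `2P` of the old gain. -/
lemma IsClosedLoop.opNorm_perturbed_le (hR : ∀ x, x ⬝ᵥ x ≤ qf Rx x)
    (h : IsClosedLoop Rx A B P K L N p)
    (hA : circNorm .op (A' - A) ≤ e) (hB : circNorm .op (B' - B) ≤ e) (he : 54 * p ^ 5 * e ≤ 1)
    {P' : Matrix (Fin n) (Fin n) ℝ} (h' : IsDARESolution Rx 1 A' B' P') :
    opNorm P' ≤ 2 * p := by
  have hl := h.isLyapunov_perturbed hR hA hB he
  have hp := hl.one_le
  refine opNorm_le_of_qf_le h'.1 (by linarith) fun x => ?_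
  exact (riccati_fixedPoint_le h'.1 h'.2 hl.tendsto_pow
    (h.perturbed_decrease hR hA hB he) x).trans (hl.upper x)

end Perturbation

/-! ### First- and second-order expansion of the Riccati solution and the gain. -/

section Expansion

variable {n m : ℕ} {Rx A A₁ P P₁ Pd L L₁ : Matrix (Fin n) (Fin n) ℝ}
  {B B₁ : Matrix (Fin n) (Fin m) ℝ} {K K₁ : Matrix (Fin m) (Fin n) ℝ}
  {N N₁ : Matrix (Fin m) (Fin m) ℝ} {p e f : ℝ} {ν : MatNorm}

lemma IsClosedLoop.gain_transpose (h : IsClosedLoop Rx A B P K L N p) :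
    Lᵀ * P * B = -Kᵀ := by
  have := congrArg transpose h.gain
  rw [transpose_neg, transpose_mul, transpose_mul, transpose_transpose, h.symm] at this
  rw [this, neg_neg, Matrix.mul_assoc]

/-- First-order optimality of `K` makes the cost identity insensitive to replacing one of its two
copies of `K` by an arbitrary `K₂`. -/
lemma IsClosedLoop.eq_mixed_left (h : IsClosedLoop Rx A B P K L N p)
    (K₂ : Matrix (Fin m) (Fin n) ℝ) : P = (A + B * K₂)ᵀ * P * L + K₂ᵀ * K + Rx := by
  have h1 : A + B * K₂ = L + B * (K₂ - K) := by
    rw [h.closed, Matrix.mul_sub]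
    abel
  have h2 : (B * (K₂ - K))ᵀ * P * L = -((K₂ - K)ᵀ * K) := by
    conv_rhs => rw [h.gain, Matrix.mul_neg, neg_neg, ← h.gain]
    simp only [transpose_mul, Matrix.mul_assoc]
  rw [h1, transpose_add, Matrix.add_mul, Matrix.add_mul, h2, transpose_sub, Matrix.sub_mul]
  conv_lhs => rw [h.cost]
  abel

lemma IsClosedLoop.eq_mixed_right (h : IsClosedLoop Rx A B P K L N p)
    (K₂ : Matrix (Fin m) (Fin n) ℝ) : P = Lᵀ * P * (A + B * K₂) + Kᵀ * K₂ + Rx := by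
  have h1 : A + B * K₂ = L + B * (K₂ - K) := by
    rw [h.closed, Matrix.mul_sub]
    abel
  rw [h1, Matrix.mul_add, ← Matrix.mul_assoc _ B, h.gain_transpose, Matrix.neg_mul, Matrix.mul_sub]
  conv_lhs => rw [h.cost]
  abel

/-- The difference of two Riccati solutions solves a Sylvester equation. -/
lemma IsClosedLoop.sub_eq_sylvester (h : IsClosedLoop Rx A B P K L N p)
    (h₁ : IsClosedLoop Rx A₁ B₁ P₁ K₁ L₁ N₁ p) :
    P₁ - P = L₁ᵀ * (P₁ - P) * L +
      (L₁ᵀ * P₁ * (A₁ - A + (B₁ - B) * K) + (A₁ - A + (B₁ - B) * K₁)ᵀ * P * L) := by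
  -- Both mixed identities contain the same term `K₁ᵀ K + Rx`, which cancels in the difference.
  have ha := h₁.eq_mixed_right K
  have hb := h.eq_mixed_left K₁
  have h1 : A₁ + B₁ * K = L + (A₁ - A + (B₁ - B) * K) := by
    rw [h.closed, Matrix.sub_mul]
    abel
  have h2 : A + B * K₁ = L₁ - (A₁ - A + (B₁ - B) * K₁) := by
    rw [h₁.closed, Matrix.sub_mul]
    abel
  rw [h1] at ha
  rw [h2] at hb
  conv_lhs => rw [ha, hb]
  simp only [transpose_sub _ (_ + _), Matrix.mul_add _ L, Matrix.mul_sub _ P₁, Matrix.sub_mul _ _ L,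
    Matrix.sub_mul _ _ P]
  abel

/-- First-order perturbation bound for the Riccati solution. -/
lemma IsClosedLoop.circNorm_riccati_sub_le (h : IsClosedLoop Rx A B P K L N p)
    (h₁ : IsClosedLoop Rx A₁ B₁ P₁ K₁ L₁ N₁ p)
    (hA : circNorm ν (A₁ - A) ≤ f) (hB : circNorm ν (B₁ - B) ≤ f) :
    circNorm ν (P₁ - P) ≤ 4 * p ^ 5 * f := by
  have hp := h.lyap.one_le
  have hD := circNorm_closedLoop_perturbation_le hp hA hB h.norm_K
  have hD₁ := circNorm_closedLoop_perturbation_le hp hA hB h₁.norm_K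
  refine (circNorm_le_of_sylvester ν h₁.lyap h.lyap (h.sub_eq_sylvester h₁) (circNorm_add_le
    (circNorm_mul_le_of_left
      (circNorm_mul_le_of_left (circNorm_transpose_le h₁.norm_L) h₁.norm_P) hD)
    (circNorm_mul_le_of_right (circNorm_mul_le_of_right (circNorm_transpose_le hD₁) h.norm_P)
      h.norm_L))).trans (le_of_eq ?_)
  ring

/-- The inhomogeneity driving the change of the gain. -/
lemma IsClosedLoop.gain_residual (h : IsClosedLoop Rx A B P K L N p)
    (D : Matrix (Fin n) (Fin n) ℝ) :
    B₁ᵀ * P₁ * (L + D) + K =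
      (B₁ - B)ᵀ * (P * L) + B₁ᵀ * ((P₁ - P) * (L + D) + P * D) := by
  conv_lhs => rw [h.gain]
  simp only [transpose_sub, Matrix.sub_mul, Matrix.mul_add, Matrix.mul_sub, Matrix.mul_assoc]
  abel

/-- The perturbed one-step cost is quadratic in the controller, so one Newton step from `K` reaches
its minimizer `K₁`; the bracket is half the gradient at `K` and `N₁` inverts half the Hessian. -/
lemma IsClosedLoop.sub_gain (h : IsClosedLoop Rx A B P K L N p)
    (h₁ : IsClosedLoop Rx A₁ B₁ P₁ K₁ L₁ N₁ p) :
    K - K₁ = N₁ * (B₁ᵀ * P₁ * (L + (A₁ - A + (B₁ - B) * K)) + K) := by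
  have h1 : L + (A₁ - A + (B₁ - B) * K) = L₁ + B₁ * (K - K₁) := by
    rw [h.closed, h₁.closed, Matrix.sub_mul, Matrix.mul_sub]
    abel
  have h2 : B₁ᵀ * P₁ * (L + (A₁ - A + (B₁ - B) * K)) + K = inputWeight B₁ P₁ * (K - K₁) := by
    rw [h1, Matrix.mul_add, inputWeight, Matrix.add_mul, Matrix.one_mul, ← Matrix.mul_assoc _ B₁]
    have h3 : B₁ᵀ * P₁ * L₁ = -K₁ := by
      conv_rhs => rw [h₁.gain, neg_neg]
    rw [h3]
    abel
  rw [h2, ← Matrix.mul_assoc, h₁.inv_mul, Matrix.one_mul]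

/-- Exact expansion of the perturbed Riccati solution around the nominal closed loop. -/
lemma IsClosedLoop.sub_eq_lyapunov (h : IsClosedLoop Rx A B P K L N p)
    (h₁ : IsClosedLoop Rx A₁ B₁ P₁ K₁ L₁ N₁ p) {D : Matrix (Fin n) (Fin n) ℝ}
    (hD : D = A₁ - A + (B₁ - B) * K) {W : Matrix (Fin m) (Fin n) ℝ}
    (hW : W = B₁ᵀ * P₁ * (L + D) + K) :
    P₁ - P = Lᵀ * (P₁ - P) * L +
      (Lᵀ * P₁ * D + Dᵀ * P₁ * L + Dᵀ * P₁ * D - Wᵀ * N₁ * W) := by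
  have h1 : A₁ + B₁ * K = L + D := by
    rw [h.closed, hD, Matrix.sub_mul]
    abel
  have h2 : A₁ + B₁ * K = L₁ + B₁ * (K - K₁) := by
    rw [h₁.closed, Matrix.mul_sub]
    abel
  have h3 : K - K₁ = N₁ * W := by
    rw [hW, hD]
    exact h.sub_gain h₁
  have ha := h₁.eq_mixed_right K
  rw [h1] at ha
  have h4 : (L + D)ᵀ * P₁ * (L + D) + Kᵀ * K = L₁ᵀ * P₁ * (L + D) + K₁ᵀ * K + Wᵀ * N₁ * W := by
    have h5 : (L + D)ᵀ = L₁ᵀ + (K - K₁)ᵀ * B₁ᵀ := by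
      rw [← h1, h2, transpose_add, transpose_mul]
    have h6 : Wᵀ * N₁ * W = (K - K₁)ᵀ * (B₁ᵀ * P₁ * (L + D) + K) := by
      rw [← hW, h3, transpose_mul, h₁.inv_symm]
    rw [h5, h6]
    simp only [transpose_sub, Matrix.add_mul, Matrix.sub_mul, Matrix.mul_add, Matrix.mul_assoc]
    abel
  -- The perturbed optimum is the one-step cost of the old gain minus the completed square, which is
  -- of second order because `W` vanishes to first order.
  have h7 : P₁ = (L + D)ᵀ * P₁ * (L + D) + Kᵀ * K - Wᵀ * N₁ * W + Rx := by
    rw [h4, add_sub_cancel_right]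
    exact ha
  have h8 : P₁ - P = (L + D)ᵀ * P₁ * (L + D) + Kᵀ * K - Wᵀ * N₁ * W + Rx -
      (Lᵀ * P * L + Kᵀ * K + Rx) := by rw [← h7, ← h.cost]
  conv_lhs => rw [h8]
  simp only [transpose_add, Matrix.add_mul, Matrix.mul_add, Matrix.mul_sub, Matrix.sub_mul]
  abel

/-- The resolvent identity, grouped so that `B₁ᵀ` always stands next to `N₁` and `B` next to `N`. -/
lemma IsClosedLoop.inv_sub_inv (h : IsClosedLoop Rx A B P K L N p)
    (h₁ : IsClosedLoop Rx A₁ B₁ P₁ K₁ L₁ N₁ p) :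
    N - N₁ = N₁ * (B₁ - B)ᵀ * (P * (B * N)) + N₁ * B₁ᵀ * ((P₁ - P) * (B * N)) +
      N₁ * B₁ᵀ * (P₁ * ((B₁ - B) * N)) := by
  have h1 : N - N₁ = N₁ * (inputWeight B₁ P₁ - inputWeight B P) * N := by
    rw [Matrix.mul_sub, h₁.inv_mul, Matrix.sub_mul, Matrix.one_mul, Matrix.mul_assoc, h.mul_inv,
      Matrix.mul_one]
  rw [h1]
  simp only [inputWeight, transpose_sub, Matrix.mul_add, Matrix.add_mul, Matrix.mul_sub,
    Matrix.sub_mul, Matrix.mul_assoc]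
  abel

lemma IsClosedLoop.norm_mul_inv (h : IsClosedLoop Rx A B P K L N p) :
    circNorm .op (B * N) ≤ 1 := by
  have := circNorm_transpose_le h.norm_inv_mul
  rwa [transpose_mul, transpose_transpose, h.inv_symm] at this

/-- Used with `X = 1` and with `X = Bᵀ`; treating the latter directly avoids a factor `‖B‖`. -/
lemma IsClosedLoop.circNorm_inv_sub_inv_mul_le {l : ℕ} (h : IsClosedLoop Rx A B P K L N p)
    (h₁ : IsClosedLoop Rx A₁ B₁ P₁ K₁ L₁ N₁ p) (X : Matrix (Fin m) (Fin l) ℝ)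
    (hA : circNorm .op (A₁ - A) ≤ e) (hB : circNorm .op (B₁ - B) ≤ e)
    (hX : circNorm .op (N * X) ≤ 1) (hBX : circNorm .op (B * N * X) ≤ 1) :
    circNorm .op ((N - N₁) * X) ≤ 6 * p ^ 5 * e := by
  have hp := h.lyap.one_le
  have he : 0 ≤ e := (circNorm_nonneg _ _).trans hA
  have h1 : (N - N₁) * X = N₁ * (B₁ - B)ᵀ * (P * (B * N * X)) +
      N₁ * B₁ᵀ * ((P₁ - P) * (B * N * X)) + N₁ * B₁ᵀ * (P₁ * ((B₁ - B) * (N * X))) := by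
    rw [h.inv_sub_inv h₁]
    simp only [Matrix.add_mul, Matrix.mul_assoc]
  rw [h1]
  refine (circNorm_add_le (circNorm_add_le
    (circNorm_mul_le_of_left (circNorm_mul_le_of_left h₁.norm_inv (circNorm_transpose_le hB))
      (circNorm_mul_le_of_left h.norm_P hBX))
    (circNorm_mul_le_of_left h₁.norm_inv_mul
      (circNorm_mul_le_of_left (h.circNorm_riccati_sub_le h₁ hA hB) hBX)))
    (circNorm_mul_le_of_left h₁.norm_inv_mul (circNorm_mul_le_of_left h₁.norm_P
      (circNorm_mul_le_of_left hB hX)))).trans ?_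
  have h2 : p * e ≤ p ^ 5 * e :=
    mul_le_mul_of_nonneg_right (le_self_pow₀ hp (by norm_num)) he
  linarith

/-- Second-order perturbation bound for the Riccati solution. -/
lemma IsClosedLoop.circNorm_riccati_sub_sub_le (h : IsClosedLoop Rx A B P K L N p)
    (h₁ : IsClosedLoop Rx A₁ B₁ P₁ K₁ L₁ N₁ p) {D : Matrix (Fin n) (Fin n) ℝ}
    (hD : D = A₁ - A + (B₁ - B) * K)
    (hPd : Pd = Lᵀ * Pd * L + (Lᵀ * P * D + Dᵀ * P * L))
    (hA : circNorm .op (A₁ - A) ≤ e) (hB : circNorm .op (B₁ - B) ≤ e) (he1 : e ≤ 1)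
    (hAf : circNorm ν (A₁ - A) ≤ f) (hBf : circNorm ν (B₁ - B) ≤ f) :
    circNorm ν (P₁ - P - Pd) ≤ 245 * p ^ 14 * (e * f) := by
  have hp := h.lyap.one_le
  have he : 0 ≤ e := (circNorm_nonneg _ _).trans hA
  have hf : 0 ≤ f := (circNorm_nonneg _ _).trans hAf
  have hDe : circNorm .op D ≤ 2 * p * e :=
    hD ▸ circNorm_closedLoop_perturbation_le hp hA hB h.norm_K
  have hDf : circNorm ν D ≤ 2 * p * f :=
    hD ▸ circNorm_closedLoop_perturbation_le hp hAf hBf h.norm_K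
  have hPe := h.circNorm_riccati_sub_le h₁ hA hB
  have hPf := h.circNorm_riccati_sub_le h₁ hAf hBf
  have hLD : circNorm .op (L + D) ≤ 3 * p :=
    (circNorm_add_le h.norm_L hDe).trans (by nlinarith)
  have hpow (k : ℕ) {g : ℝ} (hg : 0 ≤ g) (hk : k ≤ 6) : p ^ k * g ≤ p ^ 6 * g :=
    mul_le_mul_of_nonneg_right (pow_le_pow_right₀ hp hk) hg
  set Y := (P₁ - P) * (L + D) + P * D with hY
  have hYe : circNorm .op Y ≤ 14 * p ^ 6 * e := by
    refine (circNorm_add_le (circNorm_mul_le_of_right hPe hLD)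
      (circNorm_mul_le_of_left h.norm_P hDe)).trans ?_
    linarith [hpow 2 he (by norm_num)]
  have hYf : circNorm ν Y ≤ 14 * p ^ 6 * f := by
    refine (circNorm_add_le (circNorm_mul_le_of_right hPf hLD)
      (circNorm_mul_le_of_left h.norm_P hDf)).trans ?_
    linarith [hpow 2 hf (by norm_num)]
  have hGe : circNorm .op ((B₁ - B)ᵀ * (P * L)) ≤ p ^ 6 * e := by
    refine (circNorm_mul_le_of_right (circNorm_transpose_le hB)
      (circNorm_mul_le_of_left h.norm_P h.norm_L)).trans ?_
    linarith [hpow 2 he (by norm_num)]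
  have hGf : circNorm ν ((B₁ - B)ᵀ * (P * L)) ≤ p ^ 6 * f := by
    refine (circNorm_mul_le_of_right (circNorm_transpose_le hBf)
      (circNorm_mul_le_of_left h.norm_P h.norm_L)).trans ?_
    linarith [hpow 2 hf (by norm_num)]
  set G := (B₁ - B)ᵀ * (P * L) with hG
  have hWeq : B₁ᵀ * P₁ * (L + D) + K = G + B₁ᵀ * Y := h.gain_residual D
  -- Expanding `W = G + B₁ᵀ Y` puts every `B₁` beside `N₁`. The constant is `(1 + 14)²`.
  have hE : circNorm ν ((G + B₁ᵀ * Y)ᵀ * N₁ * (G + B₁ᵀ * Y)) ≤ 225 * p ^ 12 * (e * f) := by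
    have hexp : (G + B₁ᵀ * Y)ᵀ * N₁ * (G + B₁ᵀ * Y) =
        Gᵀ * (N₁ * G) + Gᵀ * (N₁ * B₁ᵀ * Y) + (Yᵀ * (B₁ * N₁) * G + Yᵀ * (B₁ * N₁ * B₁ᵀ * Y)) := by
      simp only [transpose_add, transpose_mul, transpose_transpose, Matrix.add_mul, Matrix.mul_add,
        Matrix.mul_assoc]
      abel
    rw [hexp]
    have hGT := circNorm_transpose_le hGe
    have hYT := circNorm_transpose_le hYe
    refine (circNorm_add_le (circNorm_add_le
      (circNorm_mul_le_of_left hGT (circNorm_mul_le_of_left h₁.norm_inv hGf))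
      (circNorm_mul_le_of_left hGT (circNorm_mul_le_of_left h₁.norm_inv_mul hYf)))
      (circNorm_add_le
      (circNorm_mul_le_of_left (circNorm_mul_le_of_left hYT h₁.norm_mul_inv) hGf)
      (circNorm_mul_le_of_left hYT (circNorm_mul_le_of_left h₁.norm_mul_inv_mul hYf)))).trans
      (le_of_eq ?_)
    ring
  rw [← hWeq] at hE
  have hexpand := h.sub_eq_lyapunov h₁ hD rfl
  set E := (B₁ᵀ * P₁ * (L + D) + K)ᵀ * N₁ * (B₁ᵀ * P₁ * (L + D) + K)
  have hR : P₁ - P - Pd = Lᵀ * (P₁ - P - Pd) * L +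
      (Lᵀ * ((P₁ - P) * D) + Dᵀ * (P₁ - P) * L + Dᵀ * P₁ * D - E) := by
    conv_lhs => rw [hexpand, hPd]
    simp only [Matrix.mul_sub, Matrix.sub_mul, Matrix.mul_assoc]
    abel
  have hLT := circNorm_transpose_le h.norm_L
  -- The terms give `8p⁷ + 8p⁷ + 4p³ + 225p¹²`; the Sylvester factor `p²` and `p ≥ 1` bring this to
  -- `245 p¹⁴`.
  refine (circNorm_le_of_sylvester ν h.lyap h.lyap hR (circNorm_sub_le (circNorm_add_le
    (circNorm_add_le
      (circNorm_mul_le_of_left hLT (circNorm_mul_le_of_left hPe hDf))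
      (circNorm_mul_le_of_right (circNorm_mul_le_of_right (circNorm_transpose_le hDf) hPe)
        h.norm_L))
    (circNorm_mul_le_of_left (circNorm_mul_le_of_left (circNorm_transpose_le hDe) h₁.norm_P) hDf))
    hE)).trans ?_
  have hef := mul_nonneg he hf
  have h9 : p ^ 9 * (e * f) ≤ p ^ 14 * (e * f) :=
    mul_le_mul_of_nonneg_right (pow_le_pow_right₀ hp (by norm_num)) hef
  have h5 : p ^ 5 * (e * f) ≤ p ^ 14 * (e * f) :=
    mul_le_mul_of_nonneg_right (pow_le_pow_right₀ hp (by norm_num)) hef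
  linarith

/-- Second-order perturbation bound for the optimal controller. -/
lemma IsClosedLoop.circNorm_gain_sub_le (h : IsClosedLoop Rx A B P K L N p)
    (h₁ : IsClosedLoop Rx A₁ B₁ P₁ K₁ L₁ N₁ p) {D : Matrix (Fin n) (Fin n) ℝ}
    (hD : D = A₁ - A + (B₁ - B) * K)
    (hPd : Pd = Lᵀ * Pd * L + (Lᵀ * P * D + Dᵀ * P * L))
    (hA : circNorm .op (A₁ - A) ≤ e) (hB : circNorm .op (B₁ - B) ≤ e) (he1 : e ≤ 1)
    (hAf : circNorm ν (A₁ - A) ≤ f) (hBf : circNorm ν (B₁ - B) ≤ f) :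
    circNorm ν (K₁ - (K + -(N * ((B₁ - B)ᵀ * (P * L) + Bᵀ * (Pd * L + P * D))))) ≤
      301 * p ^ 15 * (e * f) := by
  have hp := h.lyap.one_le
  have he : 0 ≤ e := (circNorm_nonneg _ _).trans hA
  have hf : 0 ≤ f := (circNorm_nonneg _ _).trans hAf
  have hDf : circNorm ν D ≤ 2 * p * f :=
    hD ▸ circNorm_closedLoop_perturbation_le hp hAf hBf h.norm_K
  have hPe := h.circNorm_riccati_sub_le h₁ hA hB
  have hR := h.circNorm_riccati_sub_sub_le h₁ hD hPd hA hB he1 hAf hBf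
  have hPdn : circNorm ν Pd ≤ 4 * p ^ 5 * f := by
    refine (circNorm_le_of_sylvester ν h.lyap h.lyap hPd (circNorm_add_le
      (circNorm_mul_le_of_left
        (circNorm_mul_le_of_left (circNorm_transpose_le h.norm_L) h.norm_P) hDf)
      (circNorm_mul_le_of_right (circNorm_mul_le_of_right (circNorm_transpose_le hDf) h.norm_P)
        h.norm_L))).trans (le_of_eq ?_)
    ring
  have hYd : circNorm ν (Pd * L + P * D) ≤ 6 * p ^ 6 * f := by
    refine (circNorm_add_le (circNorm_mul_le_of_right hPdn h.norm_L)
      (circNorm_mul_le_of_left h.norm_P hDf)).trans ?_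
    have : p ^ 2 * f ≤ p ^ 6 * f :=
      mul_le_mul_of_nonneg_right (pow_le_pow_right₀ hp (by norm_num)) hf
    linarith
  have hN : circNorm .op (N - N₁) ≤ 6 * p ^ 5 * e := by
    simpa using h.circNorm_inv_sub_inv_mul_le h₁ (1 : Matrix (Fin m) (Fin m) ℝ) hA hB
      (by simpa using h.norm_inv) (by simpa using h.norm_mul_inv)
  -- This matrix is `N Bᵀ - N₁ B₁ᵀ`, split so that no bare `B` remains.
  have hV : circNorm .op ((N - N₁) * Bᵀ - N₁ * (B₁ - B)ᵀ) ≤ 7 * p ^ 5 * e := by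
    refine (circNorm_sub_le (h.circNorm_inv_sub_inv_mul_le h₁ Bᵀ hA hB h.norm_inv_mul
      h.norm_mul_inv_mul) (circNorm_mul_le_of_left h₁.norm_inv (circNorm_transpose_le hB))).trans ?_
    have : e ≤ p ^ 5 * e := le_mul_of_one_le_left he (one_le_pow₀ hp)
    linarith
  have hZ : circNorm ν ((P₁ - P - Pd) * L + (P₁ - P) * D) ≤ 253 * p ^ 15 * (e * f) := by
    refine (circNorm_add_le (circNorm_mul_le_of_right hR h.norm_L)
      (circNorm_mul_le_of_left hPe hDf)).trans ?_
    have : p ^ 6 * (e * f) ≤ p ^ 15 * (e * f) :=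
      mul_le_mul_of_nonneg_right (pow_le_pow_right₀ hp (by norm_num)) (mul_nonneg he hf)
    linarith
  have hexp : K₁ - (K + -(N * ((B₁ - B)ᵀ * (P * L) + Bᵀ * (Pd * L + P * D)))) =
      (N - N₁) * ((B₁ - B)ᵀ * (P * L)) +
        ((N - N₁) * Bᵀ - N₁ * (B₁ - B)ᵀ) * (Pd * L + P * D) -
        N₁ * B₁ᵀ * ((P₁ - P - Pd) * L + (P₁ - P) * D) := by
    have h1 := h.sub_gain h₁
    rw [← hD, h.gain_residual D] at h1
    rw [sub_eq_iff_eq_add.1 h1]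
    simp only [transpose_sub, Matrix.mul_add, Matrix.mul_sub, Matrix.sub_mul, Matrix.mul_assoc]
    abel
  rw [hexp]
  -- The constant is `301 = 6 + 7·6 + 253`.
  refine (circNorm_sub_le (circNorm_add_le
    (circNorm_mul_le_of_left hN (circNorm_mul_le_of_right (circNorm_transpose_le hBf)
      (circNorm_mul_le_of_left h.norm_P h.norm_L)))
    (circNorm_mul_le_of_left hV hYd))
    (circNorm_mul_le_of_left h₁.norm_inv_mul hZ)).trans ?_
  have hef := mul_nonneg he hf
  have h7 : p ^ 7 * (e * f) ≤ p ^ 15 * (e * f) :=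
    mul_le_mul_of_nonneg_right (pow_le_pow_right₀ hp (by norm_num)) hef
  have h11 : p ^ 11 * (e * f) ≤ p ^ 15 * (e * f) :=
    mul_le_mul_of_nonneg_right (pow_le_pow_right₀ hp (by norm_num)) hef
  linarith

end Expansion

/-! ### Expansion along the segment, and the theorem. -/

section Main

variable {n m : ℕ}

open scoped Matrix.Norms.Frobenius in
lemma froNorm_smul (a : ℝ) (X : Matrix (Fin n) (Fin m) ℝ) : froNorm (a • X) = |a| * froNorm X :=
  norm_smul a X

lemma circNorm_smul (ν : MatNorm) (a : ℝ) (X : Matrix (Fin n) (Fin m) ℝ) :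
    circNorm ν (a • X) = |a| * circNorm ν X := by
  cases ν
  exacts [opNorm_smul a X, froNorm_smul a X]

lemma modelErr_nonneg (ν : MatNorm) (A A' : Matrix (Fin n) (Fin n) ℝ)
    (B B' : Matrix (Fin n) (Fin m) ℝ) : 0 ≤ modelErr ν A A' B B' :=
  (circNorm_nonneg ν _).trans (le_max_left _ _)

/-- Taylor expansion of the optimal controller along a segment of systems, with a remainder that is
uniform in the system. -/
lemma exists_Kinf_expansion [NeZero n] {Rx A A' : Matrix (Fin n) (Fin n) ℝ}
    {B B' : Matrix (Fin n) (Fin m) ℝ} (hR : (Rx - 1).PosSemidef) (hAB : Stabilizable A B)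
    (herr : modelErr .op A A' B B' ≤ 1 / Csafe Rx 1 A B) :
    ∃ K' : Matrix (Fin m) (Fin n) ℝ, ∀ t : ℝ, |t| ≤ 1 →
      Stabilizable (A + t • (A' - A)) (B + t • (B' - B)) ∧
      ∀ ν, circNorm ν (Kinf Rx 1 (A + t • (A' - A)) (B + t • (B' - B)) -
          (Kinf Rx 1 A B + t • K')) ≤
        301 * (2 * opNorm (Pinf Rx 1 A B)) ^ 15 *
          (modelErr .op A A' B B' * modelErr ν A A' B B') * t ^ 2 := by
  have hP := isDARESolution_Pinf (hAB.exists_isDARESolution hR)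
  have hs := hP.one_le_opNorm hR
  rw [Csafe, le_div_iff₀ (by positivity), mul_comm] at herr
  have he0 := modelErr_nonneg .op A A' B B'
  set P := Pinf Rx 1 A B
  set s := opNorm P
  set e := modelErr .op A A' B B'
  have he1 : e ≤ 1 := by
    have : e ≤ s ^ 5 * e := le_mul_of_one_le_left he0 (one_le_pow₀ hs)
    linarith
  -- The sharp constant `s` matches the smallness hypothesis; the doubled constant in `hc` is the
  -- one shared with the perturbed systems.
  have hcs := hP.isClosedLoop hR hs le_rfl
  have hc := hP.isClosedLoop hR (p := 2 * s) (by linarith) (by linarith)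
  have hR1 := one_le_of_posSemidef_sub_one hR
  set K := gain A B P
  set L := A + B * K
  set N := (inputWeight B P)⁻¹
  set D := A' - A + (B' - B) * K
  obtain ⟨Pd, hPd⟩ := exists_lyapunov_solution hc.lyap (Lᵀ * P * D + Dᵀ * P * L)
  refine ⟨-(N * ((B' - B)ᵀ * (P * L) + Bᵀ * (Pd * L + P * D))), fun t ht => ?_⟩
  have hAt (ν) : circNorm ν (A + t • (A' - A) - A) ≤ |t| * modelErr ν A A' B B' := by
    rw [add_sub_cancel_left, circNorm_smul]
    exact mul_le_mul_of_nonneg_left (le_max_left _ _) (abs_nonneg t)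
  have hBt (ν) : circNorm ν (B + t • (B' - B) - B) ≤ |t| * modelErr ν A A' B B' := by
    rw [add_sub_cancel_left, circNorm_smul]
    exact mul_le_mul_of_nonneg_left (le_max_right _ _) (abs_nonneg t)
  have hte : |t| * e ≤ e := mul_le_of_le_one_left he0 ht
  have hstab := hcs.stabilizable_perturbed hR1 ((hAt .op).trans hte) ((hBt .op).trans hte) herr
  refine ⟨hstab, fun ν => ?_⟩
  have hPt := isDARESolution_Pinf (hstab.exists_isDARESolution hR)
  have hct := hPt.isClosedLoop hR (p := 2 * s) (by linarith)
    (hcs.opNorm_perturbed_le hR1 ((hAt .op).trans hte) ((hBt .op).trans hte) herr hPt)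
  have hD : t • D = A + t • (A' - A) - A + (B + t • (B' - B) - B) * K := by
    simp only [D, add_sub_cancel_left, smul_add, Matrix.smul_mul]
  -- The Lyapunov equation is linear, so `Pd` scales with `t` and one `K'` serves every `t`.
  have hPdt : t • Pd = Lᵀ * (t • Pd) * L + (Lᵀ * P * (t • D) + (t • D)ᵀ * P * L) := by
    conv_lhs => rw [hPd]
    simp only [smul_add, transpose_smul, Matrix.smul_mul, Matrix.mul_smul]
  have key := hc.circNorm_gain_sub_le hct hD hPdt (hAt .op) (hBt .op) (hte.trans he1)
    (hAt ν) (hBt ν)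
  have hlin : -(N * ((B + t • (B' - B) - B)ᵀ * (P * L) + Bᵀ * (t • Pd * L + P * t • D))) =
      t • -(N * ((B' - B)ᵀ * (P * L) + Bᵀ * (Pd * L + P * D))) := by
    simp only [add_sub_cancel_left, transpose_smul, Matrix.smul_mul, Matrix.mul_smul, smul_neg,
      ← smul_add]
  rw [hlin] at key
  refine key.trans (le_of_eq ?_)
  rw [← sq_abs t]
  ring

end Main

end LQR

theorem mainTheorem8 :
    ∃ c p : ℝ, 0 < c ∧ 0 < p ∧
      ∀ (n m : ℕ) (Rx : Matrix (Fin n) (Fin n) ℝ) (Ru : Matrix (Fin m) (Fin m) ℝ)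
        (A A' : Matrix (Fin n) (Fin n) ℝ) (B B' : Matrix (Fin n) (Fin m) ℝ),
        (Rx - 1).PosSemidef →
        Ru = 1 →
        LQR.Stabilizable A B →
        LQR.modelErr MatNorm.op A A' B B' ≤ 1 / LQR.Csafe Rx Ru A B →
        (∀ t ∈ Set.Icc (0 : ℝ) 1, LQR.Stabilizable (A + t • (A' - A)) (B + t • (B' - B))) ∧
        ∃ K' : Matrix (Fin m) (Fin n) ℝ,
          HasDerivAt
            (fun t : ℝ => LQR.Kinf Rx Ru (A + t • (A' - A)) (B + t • (B' - B))) K' 0 ∧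
          ∀ ν : MatNorm,
            LQR.circNorm ν (LQR.Kinf Rx Ru A' B' - (LQR.Kinf Rx Ru A B + K')) ^ 2 ≤
              c * opNorm (LQR.Pinf Rx Ru A B) ^ p *
                LQR.modelErr MatNorm.op A A' B B' ^ 2 * LQR.modelErr ν A A' B B' ^ 2 := by
  -- These constants come from squaring `301 (2‖P‖)¹⁵`.
  refine ⟨(301 * 2 ^ 15) ^ 2, (30 : ℕ), by norm_num, by norm_num, ?_⟩
  rintro n m Rx _ A A' B B' hR rfl hAB herr
  rw [Real.rpow_natCast]
  rcases Nat.eq_zero_or_pos n with rfl | hn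
  -- In state dimension 0 the bound `1 ≤ ‖P‖` fails, but all matrices involved are trivial.
  · refine ⟨fun t _ => ?_, 0, ?_, fun ν => ?_⟩
    · rwa [Subsingleton.elim (A + t • (A' - A)) A, Subsingleton.elim (B + t • (B' - B)) B]
    · refine LQR.hasDerivAt_of_opNorm_sub_le (C := 0) fun t _ => ?_
      rw [LQR.opNorm_eq_zero.2 (Subsingleton.elim _ _), zero_mul]
    · rw [(LQR.circNorm_eq_zero ν).2 (Subsingleton.elim _ _), zero_pow two_ne_zero]
      have := LQR.opNorm_nonneg (LQR.Pinf Rx 1 A B)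
      positivity
  · have : NeZero n := ⟨hn.ne'⟩
    obtain ⟨K', hK'⟩ := LQR.exists_Kinf_expansion hR hAB herr
    refine ⟨fun t ht => (hK' t (abs_le.2 ⟨by linarith [ht.1], ht.2⟩)).1, K', ?_, fun ν => ?_⟩
    -- The expansion covers `|t| ≤ 1`, hence negative `t` too, so the derivative is two-sided.
    · refine LQR.hasDerivAt_of_opNorm_sub_le (C := 301 * (2 * opNorm (LQR.Pinf Rx 1 A B)) ^ 15 *
        (LQR.modelErr .op A A' B B' * LQR.modelErr .op A A' B B')) fun t ht => ?_
      simp only [zero_smul, add_zero]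
      exact (hK' t ht).2 .op
    · have h := (hK' 1 (by simp)).2 ν
      simp only [one_smul, add_sub_cancel, one_pow, mul_one] at h
      refine (pow_le_pow_left₀ (LQR.circNorm_nonneg ν _) h 2).trans (le_of_eq ?_)
      ring
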